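/- **Setting.** Fix $\mu\in\mathbb R^d$, $\sigma_\xi,\sigma_0,\eta>0$, integers $n,m,d\ge1$, and true labels $y_1,\dots,y_n\in\{\pm1\}$ that are balanced (equally many $+1$ and $-1$). The observed labels $\tilde y_i$ are independent with $\mathbb P(\tilde y_i\ne y_i)=\tau_+$ if $y_i=1$ and $\tau_-$ if $y_i=-1$; sample $i$ is *clean* if $\tilde y_i=y_i$ and *noisy* otherwise. The inputs are $x_i=[y_i\mu,\xi_i]$ with $\xi_i\sim N(0,\sigma_\xi^2I_d)$. For $x=[x^{(1)},x^{(2)}]$ the network is $f(W,x)=F_{+1}(W_{+1},x)-F_{-1}(W_{-1},x)$ with $F_j(W_j,x)=\frac1m\sum_{r=1}^m\big(\sigma(\langle w_{j,r},x^{(1)}\rangle)+\sigma(\langle w_{j,r},x^{(2)}\rangle)\big)$, $\sigma$ the ReLU ($\sigma'(z)=\mathbf 1(z\ge0)$), and $w^{(0)}_{j,r}\sim N(0,\sigma_0^2I_d)$; the labels $\tilde y_i$, the $\xi_i$ and the $w^{(0)}_{j,r}$ are all independent. Let $W^{(t)}$ be the iterates of gradient descent with learning rate $\eta$ on $\frac1n\sum_i\ell(f(W,x_i),\tilde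 y_i)$, $\ell(f,\tilde y)=\log(1+e^{-f\tilde y})$, and put $\ell_i^{(t)}=\ell(f(W^{(t)},x_i),\tilde y_i)$ and $\ell_i'^{(t)}=-1/(1+e^{\tilde y_if(W^{(t)},x_i)})$. The signal and noise coefficients start at $\gamma^{(0)}_{j,r}=\rho^{(0)}_{j,r,i}=0$ and obey $$\gamma^{(t+1)}_{j,r}=\gamma^{(t)}_{j,r}-\tfrac{\eta}{nm}\sum_i\ell_i'^{(t)}\sigma'(\langle w^{(t)}_{j,r},y_i\mu\rangle)y_i\tilde y_i\|\mu\|_2^2,\qquad \rho^{(t+1)}_{j,r,i}=\rho^{(t)}_{j,r,i}-\tfrac{\eta}{nm}\ell_i'^{(t)}\sigma'(\langle w^{(t)}_{j,r},\xi_i\rangle)j\tilde y_i\|\xi_i\|_2^2,$$ so that $w^{(t)}_{j,r}=w^{(0)}_{j,r}+j\gamma^{(t)}_{j,r}\|\mu\|_2^{-2}\mu+\sum_i\rho^{(t)}_{j,r,i}\|\xi_i\|_2^{-2}\xi_i$; let $\overline\rho=\rho\,\mathbf 1(\rho\ge0)$. The test error is $L_D^{0-1}(W)=\mathbb P(yf(W,x)<0)$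 for $y$ uniform on $\{\pm1\}$ and $x=[y\mu,\xi+\zeta]$, with $\xi$ uniform on $\{\xi_1,\dots,\xi_n\}$ and $\zeta\sim N(0,\sigma_\xi^2I_d)$, all independent. Write $\mathrm{SNR}=\|\mu\|_2/(\sigma_\xi\sqrt d)$ and $X=\eta^{-1}nm\sigma_\xi^{-2}d^{-1}$. **Proposition.** Let $c_1\le c_2$ and $0<t_1\le t_2<\frac12$ with $c_1(1-2t_2)>2$, and let $\kappa\ge1$, $p\in\mathbb N$. There are constants $C,C',a,b>0$, depending only on $c_1,c_2,t_1,t_2,\kappa,p$, such that the following holds for all $\varepsilon,\delta\in(0,1)$ and all $T^*=\widetilde\Theta(X/\varepsilon)$, meaning $$\kappa^{-1}\tfrac{X}{\varepsilon}\big(\log\tfrac{X}{\varepsilon}\big)^{-p}\le T^*\le\kappa\tfrac{X}{\varepsilon}\big(\log\tfrac{X}{\varepsilon}\big)^{p}.$$ Suppose that 1. $n\,\mathrm{SNR}^2\in[c_1,c_2]$ and $\tau_+,\tau_-\in[t_1,t_2]$; 2. $d\ge C\max\{n^2\log(nm/\delta)\log(T^*)^2,\ n\|\mu\|_2\sigma_\xi^{-1}\sqrt{\log(n/\delta)}\}$;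 3. $m\ge C\log(n/\delta)$ and $n\ge C\log(m/\delta)$; 4. $\|\mu\|_2^2\ge C\sigma_\xi^2\log(n/\delta)$; 5. $\sigma_0\le C^{-1}\min\{\sqrt n\,\sigma_\xi^{-1}d^{-1},\ \|\mu\|_2^{-1}\log(m/\delta)^{-1/2}\}$; 6. $\eta\le C^{-1}\min\{\sigma_\xi^{-2}d^{-3/2}n^2m\sqrt{\log(n/\delta)},\ \sigma_\xi^{-2}d^{-1}n\}$. Then there is a (non-random) time $T_1\in\mathbb N$ with $aX\le T_1\le bX$ such that, with probability at least $1-\delta$ over the observed labels, the noise patches and the initialization, all of the following hold. * **$T_1$ ends the first stage of training:** $\overline\rho^{(T_1)}_{\tilde y_i,r,i}\in[a,b]$ for all $i,r$ with $\langle w^{(0)}_{\tilde y_i,r},\xi_i\rangle\ge0$; $\gamma^{(T_1)}_{j,r}\in[a,b]$ for all $j,r$; $\gamma^{(T_1)}_{j,r}>\overline\rho^{(T_1)}_{\tilde y_i,r,i}$ for all $j,r,i$; $\tilde y_if(W^{(T_1)},x_i)\ge0$ for every clean $i$ and $\tilde y_if(W^{(T_1)},x_i)\le0$ for every noisy $i$.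 * **Early stopping:** $L_D^{0-1}(W^{(T_1)})\le\exp(-d/(nC'))$. * **Sample selection:** $\ell_i^{(T_1)}\le\log2$ for every clean $i$ and $\ell_i^{(T_1)}\ge\log2$ for every noisy $i$. -/

import Mathlib

open MeasureTheory ProbabilityTheory
open scoped ENNReal

namespace LabelNoise

/-- `ℝ^d` with the Euclidean norm. -/
abbrev Vec (d : ℕ) : Type := EuclideanSpace ℝ (Fin d)

/-- Signs are encoded by Booleans: `true` is `+1`, `false` is `-1`. -/
def sgn (b : Bool) : ℝ := if b then 1 else -1

/-- The isotropic Gaussian law `N(0, s² I_d)`. -/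
noncomputable def gaussianVec (d : ℕ) (s : ℝ) : Measure (Vec d) :=
  (stdGaussian (Vec d)).map fun z => s • z

/-- The ReLU activation. -/
def relu (x : ℝ) : ℝ := max 0 x

/-- The derivative of ReLU, with the convention `σ'(0) = 1`. -/
noncomputable def relu' (x : ℝ) : ℝ := if 0 ≤ x then 1 else 0

/-- The first-layer weights `w_{j,r}`, `j = ±1`, `r ∈ [m]`. -/
abbrev Weights (m d : ℕ) : Type := Bool → Fin m → Vec d

/-- `F_j(W_j, x)` for an input `x = (x⁽¹⁾, x⁽²⁾)` made of two patches. -/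
noncomputable def branch {m d : ℕ} (W : Weights m d) (j : Bool) (x : Vec d × Vec d) : ℝ :=
  (1 / (m : ℝ)) * ∑ r : Fin m, (relu (inner ℝ (W j r) x.1) + relu (inner ℝ (W j r) x.2))

/-- The two-layer CNN `f(W, x) = F_{+1}(W_{+1}, x) - F_{-1}(W_{-1}, x)`. -/
noncomputable def network {m d : ℕ} (W : Weights m d) (x : Vec d × Vec d) : ℝ :=
  branch W true x - branch W false x

/-- The logistic loss `ℓ(f, y) = log (1 + exp (-f y))`, `y = ±1`. -/
noncomputable def logisticLoss (f : ℝ) (y : Bool) : ℝ := Real.log (1 + Real.exp (-f * sgn y))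

/-- The loss derivative `-1 / (1 + exp (y f))`. -/
noncomputable def logisticLoss' (f : ℝ) (y : Bool) : ℝ := -1 / (1 + Real.exp (sgn y * f))

/-- The deterministic data of the learning problem: sample size `n`, width `m`, patch dimension
`d`, signal `μ`, noise level `σ_ξ`, initialization scale `σ₀`, learning rate `η`, flipping
probabilities `τ₊ = P(ỹ = -1 | y = 1)` and `τ₋ = P(ỹ = 1 | y = -1)`, and the ground-truth labels
`y_i` of the training set. -/
structure Setup where
  n : ℕ
  m : ℕ
  d : ℕ
  mu : Vec d
  sigmaXi : ℝ
  sigma0 : ℝ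
  eta : ℝ
  tauPos : ℝ
  tauNeg : ℝ
  y : Fin n → Bool

namespace Setup

variable (S : Setup)

/-- The flipping probability of a sample whose true label is `b`. -/
def tau (b : Bool) : ℝ := if b then S.tauPos else S.tauNeg

/-- The law of the observed label of a sample whose true label is `b`: it is `-b` with
probability `τ_b` and `b` otherwise. -/
noncomputable def labelLaw (b : Bool) : Measure Bool :=
  ENNReal.ofReal (S.tau b) • Measure.dirac (!b) + ENNReal.ofReal (1 - S.tau b) • Measure.dirac b

/-- All the randomness of training: the observed labels `ỹ_i`, the noise patches `ξ_i` and the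
initial weights `w⁽⁰⁾_{j,r}`. -/
abbrev Outcome : Type := (Fin S.n → Bool) × (Fin S.n → Vec S.d) × Weights S.m S.d

/-- The joint law of the training randomness: everything is independent, `ỹ_i` is a flipped
`y_i`, `ξ_i ∼ N(0, σ_ξ² I)` and `w⁽⁰⁾_{j,r} ∼ N(0, σ₀² I)`. -/
noncomputable def law : Measure S.Outcome :=
  (Measure.pi fun i : Fin S.n => S.labelLaw (S.y i)).prod
    ((Measure.pi fun _ : Fin S.n => gaussianVec S.d S.sigmaXi).prod
      (Measure.pi fun _ : Bool => Measure.pi fun _ : Fin S.m => gaussianVec S.d S.sigma0))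

/-- `SNR = ‖μ‖ / (σ_ξ √d)`. -/
noncomputable def snr : ℝ := ‖S.mu‖ / (S.sigmaXi * Real.sqrt S.d)

/-- The time scale `η⁻¹ n m σ_ξ⁻² d⁻¹`. -/
noncomputable def timeScale : ℝ := S.eta⁻¹ * S.n * S.m * (S.sigmaXi ^ 2)⁻¹ * (S.d : ℝ)⁻¹

variable {S}

/-- The observed label `ỹ_i`. -/
def obs (ω : S.Outcome) (i : Fin S.n) : Bool := ω.1 i

/-- The noise patch `ξ_i`. -/
def xi (ω : S.Outcome) (i : Fin S.n) : Vec S.d := ω.2.1 i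

/-- The training input `x_i = [y_i μ, ξ_i]`. -/
noncomputable def input (ω : S.Outcome) (i : Fin S.n) : Vec S.d × Vec S.d :=
  (sgn (S.y i) • S.mu, xi ω i)

/-- One step of gradient descent with learning rate `η` on the empirical logistic risk. -/
noncomputable def gdStep (ω : S.Outcome) (W : Weights S.m S.d) : Weights S.m S.d := fun j r =>
  W j r
    - (S.eta / (S.n * S.m)) • ∑ i : Fin S.n,
        (logisticLoss' (network W (input ω i)) (obs ω i) * relu' (inner ℝ (W j r) (xi ω i))
          * sgn j * sgn (obs ω i)) • xi ω i
    - (S.eta / (S.n * S.m)) • ∑ i : Fin S.n,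
        (logisticLoss' (network W (input ω i)) (obs ω i)
          * relu' (inner ℝ (W j r) (sgn (S.y i) • S.mu))
          * sgn j * sgn (S.y i) * sgn (obs ω i)) • S.mu

/-- The gradient descent iterates `W⁽ᵗ⁾`. -/
noncomputable def iter (ω : S.Outcome) : ℕ → Weights S.m S.d
  | 0 => ω.2.2
  | t + 1 => gdStep ω (iter ω t)

/-- The output `f(W⁽ᵗ⁾, x_i)` on the `i`-th training sample. -/
noncomputable def output (ω : S.Outcome) (t : ℕ) (i : Fin S.n) : ℝ :=
  network (iter ω t) (input ω i)

/-- The training loss `ℓ_i⁽ᵗ⁾` of the `i`-th sample, with respect to its observed label. -/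
noncomputable def loss (ω : S.Outcome) (t : ℕ) (i : Fin S.n) : ℝ :=
  logisticLoss (output ω t i) (obs ω i)

/-- The sample `i` is clean (belongs to `S_t`) if its observed label is the true one; otherwise it
is noisy (belongs to `S_f`). -/
def IsClean (ω : S.Outcome) (i : Fin S.n) : Prop := obs ω i = S.y i

/-- The signal coefficients `γ_{j,r}⁽ᵗ⁾`. -/
noncomputable def gam (ω : S.Outcome) (j : Bool) (r : Fin S.m) : ℕ → ℝ
  | 0 => 0
  | t + 1 => gam ω j r t
      - S.eta / (S.n * S.m) * ∑ i : Fin S.n,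
          logisticLoss' (output ω t i) (obs ω i)
            * relu' (inner ℝ (iter ω t j r) (sgn (S.y i) • S.mu))
            * sgn (S.y i) * sgn (obs ω i) * ‖S.mu‖ ^ 2

/-- The noise coefficients `ρ_{j,r,i}⁽ᵗ⁾`. -/
noncomputable def rho (ω : S.Outcome) (j : Bool) (r : Fin S.m) (i : Fin S.n) : ℕ → ℝ
  | 0 => 0
  | t + 1 => rho ω j r i t
      - S.eta / (S.n * S.m) * (logisticLoss' (output ω t i) (obs ω i)
          * relu' (inner ℝ (iter ω t j r) (xi ω i)) * sgn j * sgn (obs ω i) * ‖xi ω i‖ ^ 2)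

/-- The nonnegative part `ρ̄ = ρ 1(ρ ≥ 0)` of the noise coefficients. -/
noncomputable def rhoBar (ω : S.Outcome) (j : Bool) (r : Fin S.m) (i : Fin S.n) (t : ℕ) : ℝ :=
  if 0 ≤ rho ω j r i t then rho ω j r i t else 0

lemma update_smul_aux {d : ℕ} (a e c : ℝ) (v : Vec d) :
    ((a - e * (c * ‖v‖ ^ 2)) * (‖v‖ ^ 2)⁻¹) • v
      = (a * (‖v‖ ^ 2)⁻¹) • v - e • (c • v) := by
  by_cases h : v = 0
  · simp [h]
  · have h' : ‖v‖ ^ 2 ≠ 0 := by simpa using h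
    rw [smul_smul, ← sub_smul]
    congr 1
    field_simp

/-- The signal-noise decomposition: `γ` and `ρ` are the coefficients of the weights in the
directions of the signal and of the training noise, so they are the coefficients determined by
this identity whenever `μ, ξ_1, …, ξ_n` are linearly independent. -/
theorem signal_noise_decomposition (ω : S.Outcome) (t : ℕ) (j : Bool) (r : Fin S.m) :
    iter ω t j r = iter ω 0 j r + (sgn j * gam ω j r t * (‖S.mu‖ ^ 2)⁻¹) • S.mu
      + ∑ i : Fin S.n, (rho ω j r i t * (‖xi ω i‖ ^ 2)⁻¹) • xi ω i := by
  induction t with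
  | zero => simp [gam, rho]
  | succ t ih =>
    have h1 : ∀ i : Fin S.n, (rho ω j r i (t + 1) * (‖xi ω i‖ ^ 2)⁻¹) • xi ω i
        = (rho ω j r i t * (‖xi ω i‖ ^ 2)⁻¹) • xi ω i
          - (S.eta / (S.n * S.m)) • ((logisticLoss' (output ω t i) (obs ω i)
            * relu' (inner ℝ (iter ω t j r) (xi ω i)) * sgn j * sgn (obs ω i)) • xi ω i) := by
      intro i
      rw [← update_smul_aux]
      rfl
    have h2 : (sgn j * gam ω j r (t + 1) * (‖S.mu‖ ^ 2)⁻¹) • S.mu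
        = (sgn j * gam ω j r t * (‖S.mu‖ ^ 2)⁻¹) • S.mu
          - (S.eta / (S.n * S.m)) • ∑ i : Fin S.n,
              (logisticLoss' (output ω t i) (obs ω i)
                * relu' (inner ℝ (iter ω t j r) (sgn (S.y i) • S.mu))
                * sgn j * sgn (S.y i) * sgn (obs ω i)) • S.mu := by
      rw [← Finset.sum_smul, ← update_smul_aux]
      congr 1
      simp only [gam, mul_sub, Finset.mul_sum, Finset.sum_mul]
      congr 2
      exact Finset.sum_congr rfl fun i _ => by ring
    rw [h2, Finset.sum_congr rfl fun i _ => h1 i, Finset.sum_sub_distrib, ← Finset.smul_sum]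
    have h3 : iter ω (t + 1) j r = gdStep ω (iter ω t) j r := rfl
    rw [h3]
    simp only [gdStep]
    rw [ih]
    simp only [output]
    abel

/-- The test distribution of `(x, y)` given the training noise: `y` is uniform on `±1` and
`x = [y μ, ξ + ζ]`, where `ξ` is drawn uniformly from the training noise patches and
`ζ ∼ N(0, σ_ξ² I)`, all three independent. -/
noncomputable def testLaw (ω : S.Outcome) : Measure ((Vec S.d × Vec S.d) × Bool) :=
  ((uniformOn (Set.univ : Set Bool)).prod
    ((uniformOn (Set.univ : Set (Fin S.n))).prod (gaussianVec S.d S.sigmaXi))).map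
      fun p => ((sgn p.1 • S.mu, xi ω p.2.1 + p.2.2), p.1)

/-- The test 0-1 error `P(y f(W⁽ᵗ⁾, x) < 0)`. -/
noncomputable def testError (ω : S.Outcome) (t : ℕ) : ℝ :=
  (testLaw ω).real {p | sgn p.2 * network (iter ω t) p.1 < 0}

variable (S)

/-- The standing assumptions: all sizes and scales are positive, and the training set is
balanced. -/
structure Basic : Prop where
  n_pos : 0 < S.n
  m_pos : 0 < S.m
  d_pos : 0 < S.d
  sigmaXi_pos : 0 < S.sigmaXi
  sigma0_pos : 0 < S.sigma0
  eta_pos : 0 < S.eta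
  balanced : (Finset.univ.filter fun i => S.y i = true).card
    = (Finset.univ.filter fun i => S.y i = false).card

/-- `T` is `Θ̃(η⁻¹ ε⁻¹ n m σ_ξ⁻² d⁻¹)`, with constant `κ` and logarithmic factors of power `p`. -/
def IsMaxIter (κ : ℝ) (p : ℕ) (ε T : ℝ) : Prop :=
  κ⁻¹ * (S.timeScale / ε) / Real.log (S.timeScale / ε) ^ p ≤ T ∧
    T ≤ κ * (S.timeScale / ε) * Real.log (S.timeScale / ε) ^ p

/-- The main condition, with large constant `C`, confidence `δ` and maximal number of iterations
`T`. The orders `n SNR² = Θ(1)` and `τ₊, τ₋ = Θ(1)` are witnessed by the intervals `[c₁, c₂]` and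
`[t₁, t₂]`. -/
structure MainCondition (c₁ c₂ t₁ t₂ C δ T : ℝ) : Prop where
  snr_mem : S.n * S.snr ^ 2 ∈ Set.Icc c₁ c₂
  tauPos_mem : S.tauPos ∈ Set.Icc t₁ t₂
  tauNeg_mem : S.tauNeg ∈ Set.Icc t₁ t₂
  d_ge : C * max ((S.n : ℝ) ^ 2 * Real.log (S.n * S.m / δ) * Real.log T ^ 2)
    (S.n * ‖S.mu‖ * S.sigmaXi⁻¹ * Real.sqrt (Real.log (S.n / δ))) ≤ S.d
  m_ge : C * Real.log (S.n / δ) ≤ S.m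
  n_ge : C * Real.log (S.m / δ) ≤ S.n
  mu_ge : C * S.sigmaXi ^ 2 * Real.log (S.n / δ) ≤ ‖S.mu‖ ^ 2
  sigma0_le : S.sigma0 ≤ C⁻¹ * min (Real.sqrt S.n * S.sigmaXi⁻¹ * (S.d : ℝ)⁻¹)
    (‖S.mu‖⁻¹ * (Real.sqrt (Real.log (S.m / δ)))⁻¹)
  eta_le : S.eta ≤ C⁻¹ * min
    ((S.sigmaXi ^ 2)⁻¹ * (S.d : ℝ) ^ (-(3 / 2) : ℝ) * (S.n : ℝ) ^ 2 * S.m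
      * Real.sqrt (Real.log (S.n / δ)))
    ((S.sigmaXi ^ 2)⁻¹ * (S.d : ℝ)⁻¹ * S.n)

variable {S}

/-- The state of training that marks the end `T₁` of the first stage: the signal coefficients and
the noise coefficients of the initially active neurons are of constant order (in `[a, b]`), signal
dominates noise, clean samples are fitted and noisy ones are not. -/
structure IsStageOneEnd (a b : ℝ) (ω : S.Outcome) (T₁ : ℕ) : Prop where
  rho_order : ∀ i r, 0 ≤ inner ℝ (iter ω 0 (obs ω i) r) (xi ω i) →
    rhoBar ω (obs ω i) r i T₁ ∈ Set.Icc a b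
  gam_order : ∀ j r, gam ω j r T₁ ∈ Set.Icc a b
  signal_dominates : ∀ j r i, rhoBar ω (obs ω i) r i T₁ < gam ω j r T₁
  clean_fit : ∀ i, IsClean ω i → 0 ≤ sgn (obs ω i) * output ω T₁ i
  noisy_unfit : ∀ i, ¬ IsClean ω i → sgn (obs ω i) * output ω T₁ i ≤ 0

end Setup

end LabelNoise

/-! Write `D = σ_ξ² d` (`noiseEnergy`). Training is stopped at `⌈cX⌉` for a small constant `c`.
Since the loss derivative is at most 1 in absolute value, every coefficient stays `O(c)` up to that
time, without any bootstrap argument. Signal and noise patches are nearly orthogonal, so the inner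
products of a weight with `μ` and `ξ_i` equal the corresponding coefficients up to `O(θ)`
(`Regime.inner_mu_iter`, `Regime.inner_xi_iter`). Hence all outputs are small and all `-ℓ_i'` lie
within `lam` of 1/2 (`Regime.neg_logisticLoss'_near_half`): each sample still votes with almost the
same weight.

It remains to compare growth rates in units of `1/X`. A neuron is active on the signal of at least
one class, hence on `n/2` samples, where clean votes outnumber noisy ones. So `γ` grows at rate at
least about `c₁(1-2t₂)/4` (`Regime.gam_ge`), whereas `ρ` grows at rate at most about 1/2
(`Regime.rho_le`). The hypothesis `c₁(1-2t₂) > 2` says exactly that the difference `g` of these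
rates is positive. After `cX` steps the signal leads by at least `cg/2`, which exceeds all errors,
so the network predicts the true label: clean samples are fitted and noisy ones are not.

On a test point the same margin tolerates fresh noise with inner product at most `cg/8` with every
neuron (`Regime.test_correct`). As `σ_ξ²‖w‖² = O(n/d)` (`Regime.weight_norm_sq_le`), a larger inner
product has probability `exp(-Ω(d/n))`, and the union over `2m` neurons is absorbed by the
assumption on `d`. The required concentration is a union of seven Gaussian or Hoeffding tails
(`MainCondition.law_not_trainingEvent_le`). -/

namespace LabelNoise

/-! ### Tail bounds for Gaussian norms and inner products -/

lemma one_sub_inv_le_exp {u : ℝ} (hu : u ≤ 1 / 2) :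
    (1 - u)⁻¹ ≤ Real.exp (u + u ^ 2) := by
  rw [inv_le_iff_one_le_mul₀ (by linarith)]
  -- The bound `exp v ≥ 1 + v` only gives `(1 + u + u²)(1 - u) = 1 - u³`, which is enough for `u ≤
  -- 0`; for positive `u` the quadratic term is needed.
  rcases le_total 0 u with hu₀ | hu₀
  · have := Real.quadratic_le_exp_of_nonneg (x := u + u ^ 2) (by positivity)
    have h3 : 1 + (u + u ^ 2) + (u + u ^ 2) ^ 2 / 2 ≥
        1 + u + 3 / 2 * u ^ 2 + u ^ 3 := by
      nlinarith [pow_nonneg hu₀ 4]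
    calc (1 : ℝ) ≤ (1 + u + 3 / 2 * u ^ 2 + u ^ 3) * (1 - u) := by
          have : 0 ≤ u ^ 2 * ((1 - 2 * u) * (1 + u)) :=
            mul_nonneg (sq_nonneg u) (mul_nonneg (by linarith) (by linarith))
          nlinarith
      _ ≤ _ := mul_le_mul_of_nonneg_right (h3.le.trans this) (by linarith)
  · have := Real.add_one_le_exp (u + u ^ 2)
    calc (1 : ℝ) ≤ (u + u ^ 2 + 1) * (1 - u) := by nlinarith [sq_nonneg u]
      _ ≤ _ := mul_le_mul_of_nonneg_right this (by linarith)

lemma integrable_exp_sq_gaussianReal {t : ℝ} (ht : t < 1 / 2) :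
    Integrable (fun x : ℝ => Real.exp (t * x ^ 2)) (gaussianReal 0 1) := by
  rw [gaussianReal_of_var_ne_zero 0 one_ne_zero,
    integrable_withDensity_iff (measurable_gaussianPDF 0 1)
      (ae_of_all _ fun x => gaussianPDF_lt_top)]
  have : Integrable (fun x : ℝ => (√(2 * Real.pi))⁻¹ * Real.exp (-(1 / 2 - t) * x ^ 2)) :=
    (integrable_exp_neg_mul_sq (by linarith)).const_mul _
  refine this.congr (ae_of_all _ fun x => ?_)
  simp only [toReal_gaussianPDF, gaussianPDFReal, NNReal.coe_one, mul_one, sub_zero]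
  rw [mul_left_comm, ← Real.exp_add]
  ring_nf

lemma integral_exp_sq_gaussianReal {t : ℝ} (ht : t < 1 / 2) :
    ∫ x, Real.exp (t * x ^ 2) ∂(gaussianReal 0 1) = √((1 - 2 * t)⁻¹) := by
  rw [integral_gaussianReal_eq_integral_smul one_ne_zero]
  have : ∀ x : ℝ, gaussianPDFReal 0 1 x • Real.exp (t * x ^ 2)
      = (√(2 * Real.pi))⁻¹ * Real.exp (-(1 / 2 - t) * x ^ 2) := fun x => by
    simp only [gaussianPDFReal, NNReal.coe_one, mul_one, sub_zero, smul_eq_mul]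
    rw [mul_assoc, ← Real.exp_add]
    ring_nf
  simp_rw [this]
  rw [integral_const_mul, integral_gaussian, ← Real.sqrt_inv, ← Real.sqrt_mul (by positivity)]
  congr 1
  have h1 : (1 / 2 - t) ≠ 0 := by linarith
  have h2 : (1 - 2 * t) ≠ 0 := by linarith
  field_simp

lemma integrable_exp_norm_sq_stdGaussian (d : ℕ) {t : ℝ} (ht : t < 1 / 2) :
    Integrable (fun z : Vec d => Real.exp (t * ‖z‖ ^ 2)) (stdGaussian (Vec d)) := by
  rw [← map_pi_eq_stdGaussian,
    integrable_map_measure (by fun_prop) (by fun_prop)]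
  have h := Integrable.fintype_prod (μ := fun _ : Fin d => gaussianReal 0 1)
    (f := fun _ : Fin d => fun x : ℝ => Real.exp (t * x ^ 2))
    fun _ => integrable_exp_sq_gaussianReal ht
  refine h.congr (ae_of_all _ fun x => ?_)
  simp [EuclideanSpace.real_norm_sq_eq, Finset.mul_sum, Real.exp_sum]

lemma mgf_norm_sq_stdGaussian_le (d : ℕ) {t : ℝ} (ht : t ≤ 1 / 4) :
    mgf (fun z : Vec d => ‖z‖ ^ 2) (stdGaussian (Vec d)) t ≤ Real.exp (d * (t + 2 * t ^ 2)) := by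
  have h : mgf (fun z : Vec d => ‖z‖ ^ 2) (stdGaussian (Vec d)) t = √((1 - 2 * t)⁻¹) ^ d := by
    rw [mgf, ← map_pi_eq_stdGaussian, integral_map (by fun_prop) (by fun_prop)]
    have : ∀ x : Fin d → ℝ, Real.exp (t * ‖(WithLp.toLp 2 x : Vec d)‖ ^ 2)
        = ∏ i, Real.exp (t * x i ^ 2) := fun x => by
      simp [EuclideanSpace.real_norm_sq_eq, Finset.mul_sum, Real.exp_sum]
    simp_rw [this]
    rw [integral_fintype_prod_eq_prod (f := fun (_ : Fin d) x => Real.exp (t * x ^ 2))]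
    simp [integral_exp_sq_gaussianReal (show t < 1 / 2 by linarith)]
  rw [h, Real.exp_nat_mul]
  gcongr
  rw [Real.sqrt_le_left (Real.exp_pos _).le, ← Real.exp_nat_mul]
  refine (one_sub_inv_le_exp (by linarith)).trans (Real.exp_le_exp.2 ?_)
  push_cast
  linarith

lemma stdGaussian_norm_sq_ge_le (d : ℕ) {θ : ℝ} (h₀ : 0 ≤ θ) (h₁ : θ ≤ 1) :
    (stdGaussian (Vec d)).real {z | (1 + θ) * d ≤ ‖z‖ ^ 2} ≤ Real.exp (-(θ ^ 2 / 8 * d)) := by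
  -- The Chernoff exponent `-tθ + 2t²` is minimal at `t = θ/4`; `θ ≤ 1` keeps `t` in the range of
  -- the moment bound.
  refine (measure_ge_le_exp_mul_mgf (t := θ / 4) _ (by positivity)
    (integrable_exp_norm_sq_stdGaussian d (by linarith))).trans ?_
  refine (mul_le_mul_of_nonneg_left (mgf_norm_sq_stdGaussian_le d (by linarith))
    (Real.exp_pos _).le).trans ?_
  rw [← Real.exp_add]
  exact Real.exp_le_exp.2 (le_of_eq (by ring))

lemma stdGaussian_norm_sq_le_le (d : ℕ) {θ : ℝ} (h₀ : 0 ≤ θ) :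
    (stdGaussian (Vec d)).real {z | ‖z‖ ^ 2 ≤ (1 - θ) * d} ≤ Real.exp (-(θ ^ 2 / 8 * d)) := by
  refine (measure_le_le_exp_mul_mgf (t := -(θ / 4)) _ (by linarith)
    (integrable_exp_norm_sq_stdGaussian d (by linarith))).trans ?_
  refine (mul_le_mul_of_nonneg_left (mgf_norm_sq_stdGaussian_le d (by linarith))
    (Real.exp_pos _).le).trans ?_
  rw [← Real.exp_add]
  exact Real.exp_le_exp.2 (le_of_eq (by ring))

instance isProbabilityMeasure_gaussianVec (d : ℕ) (s : ℝ) :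
    IsProbabilityMeasure (gaussianVec d s) :=
  Measure.isProbabilityMeasure_map (by fun_prop)

lemma gaussianVec_real_apply {d : ℕ} {s : ℝ} {A : Set (Vec d)} (hA : MeasurableSet A) :
    (gaussianVec d s).real A = (stdGaussian (Vec d)).real {z | s • z ∈ A} := by
  rw [gaussianVec, map_measureReal_apply (by fun_prop) hA]
  rfl

lemma gaussianVec_norm_sq_gt_le (d : ℕ) {s : ℝ} (hs : 0 < s) {θ : ℝ} (h₀ : 0 ≤ θ) (h₁ : θ ≤ 1) :
    (gaussianVec d s).real {z | (1 + θ) * (s ^ 2 * d) < ‖z‖ ^ 2}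
      ≤ Real.exp (-(θ ^ 2 / 8 * d)) := by
  rw [gaussianVec_real_apply (measurableSet_lt (by fun_prop) (by fun_prop))]
  refine le_trans (measureReal_mono fun z hz => ?_) (stdGaussian_norm_sq_ge_le d h₀ h₁)
  simp only [Set.mem_ofPred_eq, norm_smul, mul_pow, Real.norm_eq_abs, sq_abs] at hz ⊢
  have hs2 : 0 < s ^ 2 := by positivity
  exact (lt_of_mul_lt_mul_left (by linarith) hs2.le).le

lemma gaussianVec_norm_sq_dev_le (d : ℕ) {s : ℝ} (hs : 0 < s) {θ : ℝ} (h₀ : 0 ≤ θ)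
    (h₁ : θ ≤ 1) :
    (gaussianVec d s).real {z | θ * (s ^ 2 * d) < |‖z‖ ^ 2 - s ^ 2 * d|}
      ≤ 2 * Real.exp (-(θ ^ 2 / 8 * d)) := by
  rw [gaussianVec_real_apply (measurableSet_lt (by fun_prop) (by fun_prop))]
  refine le_trans (measureReal_mono (s₂ := {z | (1 + θ) * d ≤ ‖z‖ ^ 2} ∪
    {z | ‖z‖ ^ 2 ≤ (1 - θ) * d}) fun z hz => ?_) ?_
  · simp only [Set.mem_ofPred_eq, norm_smul, mul_pow, Real.norm_eq_abs, sq_abs, lt_abs,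
      Set.mem_union] at hz ⊢
    have hs2 : 0 < s ^ 2 := by positivity
    rcases hz with hz | hz
    · exact Or.inl (le_of_mul_le_mul_left (by linarith) hs2)
    · exact Or.inr (le_of_mul_le_mul_left (by linarith) hs2)
  · refine (measureReal_union_le _ _).trans ?_
    linarith [stdGaussian_norm_sq_ge_le d h₀ h₁, stdGaussian_norm_sq_le_le d h₀]

lemma stdGaussian_hasSubgaussianMGF_inner {d : ℕ} (v : Vec d) :
    HasSubgaussianMGF (fun z : Vec d => inner ℝ v z) (‖v‖₊ ^ 2) (stdGaussian (Vec d)) := by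
  have h : (stdGaussian (Vec d)).map (fun z : Vec d => inner ℝ v z)
      = gaussianReal 0 (‖v‖₊ ^ 2) := by
    have := IsGaussian.map_eq_gaussianReal (μ := stdGaussian (Vec d)) (innerSL ℝ v)
    rw [integral_strongDual_stdGaussian, variance_dual_stdGaussian, innerSL_apply_norm] at this
    have hv : (‖v‖ ^ 2).toNNReal = ‖v‖₊ ^ 2 := by
      ext
      rw [Real.coe_toNNReal _ (by positivity)]
      simp
    rw [← hv, ← this]
    rfl
  refine ⟨fun t => ?_, fun t => ?_⟩
  · have := integrable_exp_mul_gaussianReal (μ := 0) (v := ‖v‖₊ ^ 2) t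
    rw [← h, integrable_map_measure (by fun_prop) (by fun_prop)] at this
    exact this
  · rw [mgf_gaussianReal h]
    simp

lemma exp_neg_sq_div_le {a k K : ℝ} (hk : 0 ≤ k) (hK : k ≤ K) (hk' : k ≠ 0) :
    Real.exp (-a ^ 2 / (2 * k)) ≤ Real.exp (-(a ^ 2 / (2 * K))) := by
  have : 0 < k := lt_of_le_of_ne hk hk'.symm
  rw [Real.exp_le_exp, neg_div, neg_le_neg_iff]
  gcongr

lemma gaussianVec_inner_gt_le {d : ℕ} (s : ℝ) (v : Vec d) {a K : ℝ} (ha : 0 ≤ a)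
    (hK : s ^ 2 * ‖v‖ ^ 2 ≤ K) :
    (gaussianVec d s).real {z | a < inner ℝ v z} ≤ Real.exp (-(a ^ 2 / (2 * K))) := by
  rw [gaussianVec_real_apply (measurableSet_lt (by fun_prop) (by fun_prop))]
  have hk : s ^ 2 * ‖v‖ ^ 2 = ‖s • v‖ ^ 2 := by
    rw [norm_smul, mul_pow, Real.norm_eq_abs, sq_abs]
  -- With zero variance the event is empty, but the sub-Gaussian exponent would have denominator
  -- zero and yield only the bound 1.
  by_cases h0 : s • v = 0
  · have : {z : Vec d | s • z ∈ {z : Vec d | a < inner ℝ v z}} = ∅ := by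
      ext z
      simp only [Set.mem_ofPred_eq, Set.mem_empty_iff_false, iff_false, not_lt]
      rw [real_inner_smul_right, ← real_inner_smul_left, h0, inner_zero_left]
      exact ha
    rw [this, measureReal_empty]
    exact (Real.exp_pos _).le
  · refine le_trans (measureReal_mono fun z hz => ?_)
      (((stdGaussian_hasSubgaussianMGF_inner (s • v)).measure_ge_le ha).trans
        (exp_neg_sq_div_le (K := K) ?_ ?_ ?_))
    · simp only [Set.mem_ofPred_eq] at hz ⊢
      rw [real_inner_smul_right, ← real_inner_smul_left] at hz
      exact hz.le
    · positivity
    · simpa [← hk] using hK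
    · simpa using h0

lemma gaussianVec_abs_inner_gt_le {d : ℕ} (s : ℝ) (v : Vec d) {a K : ℝ} (ha : 0 ≤ a)
    (hK : s ^ 2 * ‖v‖ ^ 2 ≤ K) :
    (gaussianVec d s).real {z | a < |inner ℝ v z|} ≤ 2 * Real.exp (-(a ^ 2 / (2 * K))) := by
  refine le_trans (measureReal_mono (s₂ := {z | a < inner ℝ v z} ∪ {z | a < inner ℝ (-v) z})
    fun z hz => ?_) ((measureReal_union_le _ _).trans ?_)
  · simpa [lt_abs] using hz
  · linarith [gaussianVec_inner_gt_le s v ha hK,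
      gaussianVec_inner_gt_le s (-v) ha (by simpa using hK)]

lemma prod_real_le_of_forall_section_le {α β : Type*} [MeasurableSpace α] [MeasurableSpace β]
    (μ : Measure α) (ν : Measure β) [IsProbabilityMeasure μ] [IsProbabilityMeasure ν]
    {A : Set (α × β)} (hA : MeasurableSet A) {q : ℝ} (hq : 0 ≤ q)
    (h : ∀ x, ν.real (Prod.mk x ⁻¹' A) ≤ q) : (μ.prod ν).real A ≤ q := by
  refine ENNReal.toReal_le_of_le_ofReal hq ?_
  rw [Measure.prod_apply hA]
  calc ∫⁻ x, ν (Prod.mk x ⁻¹' A) ∂μ ≤ ∫⁻ _, ENNReal.ofReal q ∂μ := by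
        refine lintegral_mono fun x => ?_
        rw [ENNReal.le_ofReal_iff_toReal_le (measure_ne_top _ _) hq]
        exact h x
    _ = ENNReal.ofReal q := by simp

/-- Conditionally on the first vector the inner product is Gaussian. The truncation of the norm is
part of the event, so that the conditional variance is bounded on every nonempty section. -/
lemma gaussianVec_prod_abs_inner_gt_le {d : ℕ} (s s' : ℝ) {a K L : ℝ} (ha : 0 ≤ a)
    (hL : s' ^ 2 * K ≤ L) :
    ((gaussianVec d s).prod (gaussianVec d s')).real
      {p | ‖p.1‖ ^ 2 ≤ K ∧ a < |inner ℝ p.1 p.2|} ≤ 2 * Real.exp (-(a ^ 2 / (2 * L))) := by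
  refine prod_real_le_of_forall_section_le _ _ ?_ (by positivity) fun x => ?_
  · have h₁ : Measurable fun p : Vec d × Vec d => ‖p.1‖ ^ 2 := by fun_prop
    have h₂ : Measurable fun p : Vec d × Vec d => |(inner ℝ p.1 p.2 : ℝ)| := by fun_prop
    exact (measurableSet_le h₁ measurable_const).inter (measurableSet_lt measurable_const h₂)
  · by_cases hx : ‖x‖ ^ 2 ≤ K
    · refine le_trans (measureReal_mono fun z hz => hz.2) (gaussianVec_abs_inner_gt_le s' x ha
        (le_trans ?_ hL))
      gcongr
    · have : Prod.mk x ⁻¹' {p : Vec d × Vec d | ‖p.1‖ ^ 2 ≤ K ∧ a < |inner ℝ p.1 p.2|} = ∅ := by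
        ext z
        simp [hx]
      rw [this, measureReal_empty]
      positivity

/-! ### Elementary facts on ReLU, logistic loss and branches -/

@[simp] lemma sgn_mul_self (b : Bool) : sgn b * sgn b = 1 := by cases b <;> simp [sgn]

@[simp] lemma abs_sgn (b : Bool) : |sgn b| = 1 := by cases b <;> simp [sgn]

lemma relu'_nonneg (x : ℝ) : 0 ≤ relu' x := by unfold relu'; split_ifs <;> norm_num

lemma relu'_le_one (x : ℝ) : relu' x ≤ 1 := by unfold relu'; split_ifs <;> norm_num

lemma relu'_of_nonneg {x : ℝ} (hx : 0 ≤ x) : relu' x = 1 := if_pos hx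

lemma relu_nonneg (x : ℝ) : 0 ≤ relu x := le_max_left _ _

lemma le_relu (x : ℝ) : x ≤ relu x := le_max_right _ _

lemma relu_le {x y : ℝ} (hy : 0 ≤ y) (h : x ≤ y) : relu x ≤ y := max_le hy h

lemma neg_logisticLoss'_nonneg (f : ℝ) (b : Bool) : 0 ≤ -logisticLoss' f b := by
  unfold logisticLoss'
  rw [neg_div, neg_neg]
  positivity

lemma neg_logisticLoss'_le_one (f : ℝ) (b : Bool) : -logisticLoss' f b ≤ 1 := by
  unfold logisticLoss'
  rw [neg_div, neg_neg, div_le_one (by positivity)]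
  linarith [Real.exp_pos (sgn b * f)]

/-- The logistic function takes the value 1/2 at 0, and its values at `x` and `-x` sum to 1; so a
one-sided bound for all `x` gives both sides. -/
lemma abs_neg_logisticLoss'_sub_half_le (f : ℝ) (b : Bool) :
    |-logisticLoss' f b - 1 / 2| ≤ |f| := by
  have key : ∀ x : ℝ, 1 / (1 + Real.exp x) ≤ 1 / 2 + |x| := fun x => by
    rw [div_le_iff₀ (by positivity)]
    have h1 := Real.add_one_le_exp x
    have h2 := neg_abs_le x
    nlinarith [abs_nonneg x, mul_nonneg (abs_nonneg x) (Real.exp_pos x).le]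
  have hf : |sgn b * f| = |f| := by rw [abs_mul, abs_sgn, one_mul]
  have h1 := key (sgn b * f)
  have h2 := key (-(sgn b * f))
  have h3 : 1 / (1 + Real.exp (sgn b * f)) + 1 / (1 + Real.exp (-(sgn b * f))) = 1 := by
    rw [Real.exp_neg]
    have := Real.exp_pos (sgn b * f)
    field_simp
    ring
  rw [abs_neg] at h2
  rw [hf] at h1 h2
  unfold logisticLoss'
  rw [neg_div, neg_neg, abs_le]
  constructor <;> linarith

lemma logisticLoss_le_log_two {f : ℝ} {b : Bool} (h : 0 ≤ sgn b * f) :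
    logisticLoss f b ≤ Real.log 2 := by
  refine Real.log_le_log (by positivity) ?_
  have : Real.exp (-f * sgn b) ≤ 1 := Real.exp_le_one_iff.2 (by linarith)
  linarith

lemma log_two_le_logisticLoss {f : ℝ} {b : Bool} (h : sgn b * f ≤ 0) :
    Real.log 2 ≤ logisticLoss f b := by
  refine Real.log_le_log (by norm_num) ?_
  have : 1 ≤ Real.exp (-f * sgn b) := Real.one_le_exp (by linarith)
  linarith

lemma branch_le {m d : ℕ} (hm : 0 < m) {W : Weights m d} {j : Bool} {x : Vec d × Vec d} {a : ℝ}
    (h : ∀ r, relu (inner ℝ (W j r) x.1) + relu (inner ℝ (W j r) x.2) ≤ a) :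
    branch W j x ≤ a := by
  have hm' : (0 : ℝ) < m := by exact_mod_cast hm
  unfold branch
  rw [one_div, inv_mul_le_iff₀ hm']
  refine (Finset.sum_le_card_nsmul _ _ a fun r _ => h r).trans (by simp)

lemma le_branch {m d : ℕ} (hm : 0 < m) {W : Weights m d} {j : Bool} {x : Vec d × Vec d} {a : ℝ}
    (h : ∀ r, a ≤ relu (inner ℝ (W j r) x.1) + relu (inner ℝ (W j r) x.2)) :
    a ≤ branch W j x := by
  have hm' : (0 : ℝ) < m := by exact_mod_cast hm
  unfold branch
  rw [one_div, le_inv_mul_iff₀ hm']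
  refine le_trans (by simp) (Finset.card_nsmul_le_sum _ _ a fun r _ => h r)

lemma sgn_mul_network {m d : ℕ} (W : Weights m d) (b : Bool) (x : Vec d × Vec d) :
    sgn b * network W x = branch W b x - branch W (!b) x := by
  cases b <;> simp [sgn, network]

/-! ### The concentration event and a priori bounds on the coefficients -/

namespace Setup

/-- The typical squared norm `σ_ξ² d` of a noise patch. -/
def noiseEnergy (S : Setup) : ℝ := S.sigmaXi ^ 2 * S.d

/-- The concentration event on which the first stage of training is controlled. -/
structure TrainingEvent {S : Setup} (t₂ θ : ℝ) (ω : S.Outcome) : Prop where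
  norm_xi : ∀ i, |‖xi ω i‖ ^ 2 - S.noiseEnergy| ≤ θ * S.noiseEnergy
  inner_xi : ∀ i k, i ≠ k → |(inner ℝ (xi ω i) (xi ω k) : ℝ)| ≤ θ * (S.noiseEnergy / S.n)
  inner_mu : ∀ i, |(inner ℝ S.mu (xi ω i) : ℝ)| ≤ θ * (S.noiseEnergy / S.n)
  init_mu : ∀ j r, |(inner ℝ S.mu (iter ω 0 j r) : ℝ)| ≤ θ
  init_xi : ∀ i j r, |(inner ℝ (xi ω i) (iter ω 0 j r) : ℝ)| ≤ θ
  init_norm : ∀ j r, ‖iter ω 0 j r‖ ^ 2 ≤ 2 * (S.sigma0 ^ 2 * S.d)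
  noisy_card : ∀ b, ((Finset.univ.filter fun i => S.y i = b ∧ obs ω i ≠ S.y i).card : ℝ)
    ≤ (t₂ + θ) * (S.n / 2)

/-- The deterministic relations between the parameters during the first stage, where `c` is the
length of the stage in units of the time scale, `θ` the accuracy of the concentration event, `lam`
a bound on the deviation of the loss derivatives from `-1/2`, and `g` the gap between the rates at
which signal and noise are learned. -/
structure Regime (S : Setup) (c₁ c₂ t₂ c θ lam g : ℝ) (T : ℕ) : Prop where
  basic : S.Basic
  two_le : 2 ≤ c₁
  c_le : c₁ ≤ c₂
  signal_ge : c₁ * S.noiseEnergy ≤ S.n * ‖S.mu‖ ^ 2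
  signal_le : S.n * ‖S.mu‖ ^ 2 ≤ c₂ * S.noiseEnergy
  theta_pos : 0 < θ
  theta_le : θ ≤ 1 / 16
  c_pos : 0 < c
  c_le_half : c ≤ 1 / 2
  lam_eq : lam = 2 * c * (c₂ + 2) + 2 * (θ * (c₂ + 5))
  lam_le : lam ≤ 1 / 4
  gap_eq : g = c₁ * (1 - 2 * t₂) / 4 - 1 / 2
  gap_pos : 0 < g
  gap_ge : (c₁ / 2 + 1) * (θ + lam) ≤ g / 2
  err_le : 24 * (θ * (c₂ + 5)) ≤ c * g
  time_ge : c ≤ T / S.timeScale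
  time_le : T / S.timeScale ≤ 2 * c

variable {S : Setup} {c₁ c₂ t₂ c θ lam g : ℝ} {T : ℕ} {ω : S.Outcome}

lemma Basic.noiseEnergy_pos (h : S.Basic) : 0 < S.noiseEnergy := by
  have := h.sigmaXi_pos
  have : (0 : ℝ) < S.d := by exact_mod_cast h.d_pos
  unfold noiseEnergy
  positivity

lemma Basic.timeScale_pos (h : S.Basic) : 0 < S.timeScale := by
  have := h.sigmaXi_pos
  have := h.eta_pos
  have : (0 : ℝ) < S.d := by exact_mod_cast h.d_pos
  have : (0 : ℝ) < S.n := by exact_mod_cast h.n_pos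
  have : (0 : ℝ) < S.m := by exact_mod_cast h.m_pos
  unfold timeScale
  positivity

lemma Basic.step_pos (h : S.Basic) : 0 < S.eta / (S.n * S.m) := by
  have := h.eta_pos
  have : (0 : ℝ) < S.n := by exact_mod_cast h.n_pos
  have : (0 : ℝ) < S.m := by exact_mod_cast h.m_pos
  positivity

/-- This identity fixes the unit of time: under unit drive a noise coefficient moves by about `1/X`
per step, so `t / S.timeScale` is the natural clock. -/
lemma Basic.step_mul_noiseEnergy (h : S.Basic) :
    S.eta / (S.n * S.m) * S.noiseEnergy = S.timeScale⁻¹ := by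
  have := h.sigmaXi_pos
  have := h.eta_pos
  have : (0 : ℝ) < S.d := by exact_mod_cast h.d_pos
  have : (0 : ℝ) < S.n := by exact_mod_cast h.n_pos
  have : (0 : ℝ) < S.m := by exact_mod_cast h.m_pos
  unfold timeScale noiseEnergy
  field_simp

/-- The rate `-ℓ_i'⁽ᵗ⁾ σ'(z)` at which an inner product `z` is driven by the `i`-th sample. -/
noncomputable def drive (ω : S.Outcome) (t : ℕ) (i : Fin S.n) (z : ℝ) : ℝ :=
  -logisticLoss' (output ω t i) (obs ω i) * relu' z

lemma drive_nonneg (ω : S.Outcome) (t : ℕ) (i : Fin S.n) (z : ℝ) : 0 ≤ drive ω t i z :=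
  mul_nonneg (neg_logisticLoss'_nonneg _ _) (relu'_nonneg _)

lemma drive_le_one (ω : S.Outcome) (t : ℕ) (i : Fin S.n) (z : ℝ) : drive ω t i z ≤ 1 :=
  mul_le_one₀ (neg_logisticLoss'_le_one _ _) (relu'_nonneg _) (relu'_le_one _)

lemma abs_drive_le_one (ω : S.Outcome) (t : ℕ) (i : Fin S.n) (z : ℝ) : |drive ω t i z| ≤ 1 := by
  rw [abs_of_nonneg (drive_nonneg ω t i z)]
  exact drive_le_one ω t i z

lemma rho_succ (ω : S.Outcome) (j : Bool) (r : Fin S.m) (i : Fin S.n) (t : ℕ) :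
    rho ω j r i (t + 1) = rho ω j r i t + S.eta / (S.n * S.m) *
      (drive ω t i (inner ℝ (iter ω t j r) (xi ω i)) * (sgn j * sgn (obs ω i))
        * ‖xi ω i‖ ^ 2) := by
  simp only [rho, drive]
  ring

lemma gam_succ (ω : S.Outcome) (j : Bool) (r : Fin S.m) (t : ℕ) :
    gam ω j r (t + 1) = gam ω j r t + S.eta / (S.n * S.m) * (‖S.mu‖ ^ 2 *
      ∑ i, drive ω t i (inner ℝ (iter ω t j r) (sgn (S.y i) • S.mu))
        * (sgn (S.y i) * sgn (obs ω i))) := by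
  simp only [gam, drive, Finset.mul_sum]
  rw [sub_eq_add_neg, ← Finset.sum_neg_distrib]
  congr 1
  exact Finset.sum_congr rfl fun i _ => by ring

lemma TrainingEvent.norm_sq_xi_le (E : TrainingEvent t₂ θ ω) (i : Fin S.n) :
    ‖xi ω i‖ ^ 2 ≤ (1 + θ) * S.noiseEnergy := by
  linarith [(abs_le.1 (E.norm_xi i)).2]

lemma TrainingEvent.le_norm_sq_xi (E : TrainingEvent t₂ θ ω) (i : Fin S.n) :
    (1 - θ) * S.noiseEnergy ≤ ‖xi ω i‖ ^ 2 := by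
  linarith [(abs_le.1 (E.norm_xi i)).1]

lemma Regime.half_le_norm_sq_xi (R : Regime S c₁ c₂ t₂ c θ lam g T) (E : TrainingEvent t₂ θ ω)
    (i : Fin S.n) : S.noiseEnergy / 2 ≤ ‖xi ω i‖ ^ 2 := by
  have := R.basic.noiseEnergy_pos
  nlinarith [E.le_norm_sq_xi i, R.theta_le]

lemma abs_sgn_mul_sgn (a b : Bool) : |sgn a * sgn b| = 1 := by simp [abs_mul]

/-- Only `|ℓ'| ≤ 1` and `‖ξ_i‖² ≤ 2D` are used, nothing about the outputs. The later smallness of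
the outputs therefore rests on no circular argument. -/
lemma Regime.abs_rho_le (R : Regime S c₁ c₂ t₂ c θ lam g T) (E : TrainingEvent t₂ θ ω)
    (j : Bool) (r : Fin S.m) (i : Fin S.n) (t : ℕ) :
    |rho ω j r i t| ≤ 2 * (t / S.timeScale) := by
  have hD := R.basic.noiseEnergy_pos
  have hh := R.basic.step_pos
  induction t with
  | zero => simp [rho]
  | succ t ih =>
    rw [rho_succ]
    refine (abs_add_le _ _).trans ?_
    have h1 : ‖xi ω i‖ ^ 2 ≤ 2 * S.noiseEnergy := by
      nlinarith [E.norm_sq_xi_le i, R.theta_le]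
    have h2 : |S.eta / (S.n * S.m) * (drive ω t i (inner ℝ (iter ω t j r) (xi ω i))
        * (sgn j * sgn (obs ω i)) * ‖xi ω i‖ ^ 2)| ≤ 2 * S.timeScale⁻¹ := by
      rw [abs_mul, abs_of_pos hh, abs_mul, abs_mul, abs_sgn_mul_sgn, mul_one,
        abs_of_nonneg (sq_nonneg ‖xi ω i‖), ← R.basic.step_mul_noiseEnergy]
      calc _ ≤ S.eta / (S.n * S.m) * (1 * (2 * S.noiseEnergy)) := by
            gcongr
            exact abs_drive_le_one _ _ _ _
        _ = _ := by ring
    push_cast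
    rw [add_div, one_div]
    linarith

lemma abs_signal_drive_le (ω : S.Outcome) (t : ℕ) (j : Bool) (r : Fin S.m) :
    |∑ i, drive ω t i (inner ℝ (iter ω t j r) (sgn (S.y i) • S.mu))
      * (sgn (S.y i) * sgn (obs ω i))| ≤ S.n := by
  refine (Finset.abs_sum_le_sum_abs _ _).trans ?_
  refine (Finset.sum_le_card_nsmul _ _ 1 fun i _ => ?_).trans (by simp)
  rw [abs_mul, abs_sgn_mul_sgn, mul_one]
  exact abs_drive_le_one _ _ _ _

lemma Regime.abs_gam_le (R : Regime S c₁ c₂ t₂ c θ lam g T)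
    (ω : S.Outcome) (j : Bool) (r : Fin S.m) (t : ℕ) :
    |gam ω j r t| ≤ c₂ * (t / S.timeScale) := by
  have hh := R.basic.step_pos
  induction t with
  | zero => simp [gam]
  | succ t ih =>
    rw [gam_succ]
    refine (abs_add_le _ _).trans ?_
    have h2 : |S.eta / (S.n * S.m) * (‖S.mu‖ ^ 2 *
      ∑ i, drive ω t i (inner ℝ (iter ω t j r) (sgn (S.y i) • S.mu))
        * (sgn (S.y i) * sgn (obs ω i)))| ≤ c₂ * S.timeScale⁻¹ := by
      rw [abs_mul, abs_of_pos hh, abs_mul, abs_of_nonneg (sq_nonneg _),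
        ← R.basic.step_mul_noiseEnergy]
      have h3 := abs_signal_drive_le ω t j r
      calc _ ≤ S.eta / (S.n * S.m) * (‖S.mu‖ ^ 2 * S.n) := by gcongr
        _ ≤ S.eta / (S.n * S.m) * (c₂ * S.noiseEnergy) := by
            refine mul_le_mul_of_nonneg_left ?_ hh.le
            linarith [R.signal_le]
        _ = _ := by ring
    push_cast
    rw [add_div, one_div]
    linarith

lemma Regime.time_le_of_le (R : Regime S c₁ c₂ t₂ c θ lam g T) {t : ℕ} (ht : t ≤ T) :
    t / S.timeScale ≤ 2 * c := by
  refine le_trans ?_ R.time_le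
  have := R.basic.timeScale_pos
  gcongr

/-- The noise coefficient contribution of one sample to the inner product with a direction almost
orthogonal to it. -/
lemma Regime.abs_rho_term_le (R : Regime S c₁ c₂ t₂ c θ lam g T) (E : TrainingEvent t₂ θ ω)
    (j : Bool) (r : Fin S.m) (k : Fin S.n) {t : ℕ} (ht : t ≤ T) {z : ℝ}
    (hz : |z| ≤ θ * (S.noiseEnergy / S.n)) :
    |rho ω j r k t * (‖xi ω k‖ ^ 2)⁻¹ * z| ≤ 4 * θ / S.n := by
  have hD := R.basic.noiseEnergy_pos
  have hn : (0 : ℝ) < S.n := by exact_mod_cast R.basic.n_pos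
  have hρ : |rho ω j r k t| ≤ 2 := by
    linarith [R.abs_rho_le E j r k t, R.time_le_of_le ht, R.c_le_half]
  have hx := R.half_le_norm_sq_xi E k
  rw [abs_mul, abs_mul, abs_of_nonneg (a := (‖xi ω k‖ ^ 2)⁻¹) (by positivity)]
  calc _ ≤ 2 * (S.noiseEnergy / 2)⁻¹ * (θ * (S.noiseEnergy / S.n)) := by gcongr
    _ = _ := by field_simp; ring

lemma inner_iter (ω : S.Outcome) (t : ℕ) (j : Bool) (r : Fin S.m) (v : Vec S.d) :
    (inner ℝ v (iter ω t j r) : ℝ) = inner ℝ v (iter ω 0 j r)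
      + sgn j * gam ω j r t * (‖S.mu‖ ^ 2)⁻¹ * inner ℝ v S.mu
      + ∑ k, rho ω j r k t * (‖xi ω k‖ ^ 2)⁻¹ * inner ℝ v (xi ω k) := by
  conv_lhs => rw [signal_noise_decomposition]
  simp only [inner_add_right, inner_sum, real_inner_smul_right]

lemma Regime.norm_mu_sq_pos (R : Regime S c₁ c₂ t₂ c θ lam g T) : 0 < ‖S.mu‖ ^ 2 := by
  have hD := R.basic.noiseEnergy_pos
  have hn : (0 : ℝ) < S.n := by exact_mod_cast R.basic.n_pos
  have := R.two_le
  have h : 0 < S.n * ‖S.mu‖ ^ 2 := lt_of_lt_of_le (by positivity) R.signal_ge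
  exact pos_of_mul_pos_right h hn.le

lemma Regime.err_nonneg (R : Regime S c₁ c₂ t₂ c θ lam g T) : 0 ≤ θ * (c₂ + 5) := by
  have := R.theta_pos
  have : 0 ≤ c₂ + 5 := by linarith [R.two_le, R.c_le]
  positivity

/-- The initialization costs `θ` and the `n` noise directions cost `4θ/n` each. The weaker constant
`c₂ + 5` is shared with the estimate for `ξ_i`. -/
lemma Regime.inner_mu_iter (R : Regime S c₁ c₂ t₂ c θ lam g T) (E : TrainingEvent t₂ θ ω)
    {t : ℕ} (ht : t ≤ T) (j : Bool) (r : Fin S.m) :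
    |(inner ℝ S.mu (iter ω t j r) : ℝ) - sgn j * gam ω j r t| ≤ θ * (c₂ + 5) := by
  have hn : (0 : ℝ) < S.n := by exact_mod_cast R.basic.n_pos
  have hM := R.norm_mu_sq_pos
  have hθ := R.theta_pos
  rw [inner_iter, real_inner_self_eq_norm_sq, inv_mul_cancel_right₀ hM.ne']
  have h1 : |∑ k, rho ω j r k t * (‖xi ω k‖ ^ 2)⁻¹ * inner ℝ S.mu (xi ω k)| ≤ 4 * θ := by
    refine (Finset.abs_sum_le_sum_abs _ _).trans ?_
    refine (Finset.sum_le_card_nsmul _ _ _ fun k _ =>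
      R.abs_rho_term_le E j r k ht (E.inner_mu k)).trans (le_of_eq ?_)
    simp only [Finset.card_univ, Fintype.card_fin, nsmul_eq_mul]
    field_simp
  have h2 := E.init_mu j r
  have h3 : 0 ≤ θ * c₂ := mul_nonneg hθ.le (by linarith [R.two_le, R.c_le])
  calc _ = |(inner ℝ S.mu (iter ω 0 j r) : ℝ)
        + ∑ k, rho ω j r k t * (‖xi ω k‖ ^ 2)⁻¹ * inner ℝ S.mu (xi ω k)| := by congr 1; ring
    _ ≤ _ := (abs_add_le _ _).trans (by linarith)

/-- The accuracy `θD/n` of the concentration event is what makes the cross terms harmless: summed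
over the other samples they give at most `4θ`, and since `D/n ≤ ‖μ‖²` the signal component
contributes at most `θc₂`. -/
lemma Regime.inner_xi_iter (R : Regime S c₁ c₂ t₂ c θ lam g T) (E : TrainingEvent t₂ θ ω)
    {t : ℕ} (ht : t ≤ T) (j : Bool) (r : Fin S.m) (i : Fin S.n) :
    |(inner ℝ (xi ω i) (iter ω t j r) : ℝ) - rho ω j r i t| ≤ θ * (c₂ + 5) := by
  have hD := R.basic.noiseEnergy_pos
  have hn : (0 : ℝ) < S.n := by exact_mod_cast R.basic.n_pos
  have hM := R.norm_mu_sq_pos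
  have hθ := R.theta_pos
  have hc₂ : 0 ≤ c₂ := by linarith [R.two_le, R.c_le]
  have hx : ‖xi ω i‖ ^ 2 ≠ 0 := by linarith [R.half_le_norm_sq_xi E i]
  rw [inner_iter, ← Finset.add_sum_erase _ _ (Finset.mem_univ i), real_inner_self_eq_norm_sq,
    inv_mul_cancel_right₀ hx]
  have h1 : |∑ k ∈ Finset.univ.erase i, rho ω j r k t * (‖xi ω k‖ ^ 2)⁻¹
      * inner ℝ (xi ω i) (xi ω k)| ≤ 4 * θ := by
    refine (Finset.abs_sum_le_sum_abs _ _).trans ?_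
    refine (Finset.sum_le_card_nsmul _ _ (4 * θ / S.n) fun k hk =>
      R.abs_rho_term_le E j r k ht (E.inner_xi i k (Finset.ne_of_mem_erase hk).symm)).trans ?_
    rw [nsmul_eq_mul]
    calc _ ≤ (S.n : ℝ) * (4 * θ / S.n) := by
          gcongr
          refine (Finset.card_le_univ _).trans (by simp)
      _ = _ := by field_simp
  have h2 := E.init_xi i j r
  have h3 : |sgn j * gam ω j r t * (‖S.mu‖ ^ 2)⁻¹ * inner ℝ (xi ω i) S.mu| ≤ θ * c₂ := by
    have hγ : |gam ω j r t| ≤ c₂ := by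
      have := R.abs_gam_le ω j r t
      have h5 : t / S.timeScale ≤ 1 := by linarith [R.time_le_of_le ht, R.c_le_half]
      nlinarith
    rw [abs_mul, abs_mul, abs_mul, abs_sgn, one_mul,
      abs_of_nonneg (a := (‖S.mu‖ ^ 2)⁻¹) (by positivity), real_inner_comm]
    have h4 : S.noiseEnergy / S.n ≤ ‖S.mu‖ ^ 2 := by
      rw [div_le_iff₀ hn]
      nlinarith [R.signal_ge, R.two_le]
    calc _ ≤ c₂ * (‖S.mu‖ ^ 2)⁻¹ * (θ * ‖S.mu‖ ^ 2) := by
          gcongr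
          exact (E.inner_mu i).trans (by gcongr)
      _ = _ := by rw [mul_assoc, mul_left_comm _ θ, inv_mul_cancel₀ hM.ne']; ring
  calc _ = |(inner ℝ (xi ω i) (iter ω 0 j r) : ℝ)
        + sgn j * gam ω j r t * (‖S.mu‖ ^ 2)⁻¹ * inner ℝ (xi ω i) S.mu
        + ∑ k ∈ Finset.univ.erase i, rho ω j r k t * (‖xi ω k‖ ^ 2)⁻¹
          * inner ℝ (xi ω i) (xi ω k)| := by congr 1; ring
    _ ≤ _ := (abs_add_three _ _ _).trans (by linarith)

/-! ### Near-constant loss derivatives and the resulting growth rates -/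

lemma Regime.branch_bound (R : Regime S c₁ c₂ t₂ c θ lam g T) (E : TrainingEvent t₂ θ ω)
    {t : ℕ} (ht : t ≤ T) (j : Bool) (i : Fin S.n) :
    branch (iter ω t) j (input ω i) ≤ lam := by
  refine branch_le R.basic.m_pos fun r => ?_
  have hc₂ : 0 ≤ c₂ := by linarith [R.two_le, R.c_le]
  have hτ := R.time_le_of_le ht
  have hc := R.c_pos
  have he := R.err_nonneg
  have h1 : relu (inner ℝ (iter ω t j r) (input ω i).1) ≤ 2 * c * c₂ + θ * (c₂ + 5) := by
    refine relu_le (by positivity) ?_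
    have h2 := abs_le.1 (R.inner_mu_iter E ht j r)
    have h3 := abs_le.1 (R.abs_gam_le ω j r t)
    have h4 : c₂ * (t / S.timeScale) ≤ c₂ * (2 * c) := by gcongr
    simp only [input]
    rw [real_inner_smul_right, real_inner_comm]
    generalize (inner ℝ S.mu (iter ω t j r) : ℝ) = z at *
    generalize gam ω j r t = γ at *
    cases j <;> cases S.y i <;> simp only [sgn] at h2 ⊢ <;> norm_num at h2 ⊢ <;> linarith
  have h2 : relu (inner ℝ (iter ω t j r) (input ω i).2) ≤ 2 * c * 2 + θ * (c₂ + 5) := by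
    refine relu_le (by positivity) ?_
    have h2 := abs_le.1 (R.inner_xi_iter E ht j r i)
    have h3 := abs_le.1 (R.abs_rho_le E j r i t)
    simp only [input]
    rw [real_inner_comm]
    linarith
  rw [R.lam_eq]
  linarith

lemma branch_nonneg {m d : ℕ} (W : Weights m d) (j : Bool) (x : Vec d × Vec d) :
    0 ≤ branch W j x :=
  mul_nonneg (by positivity)
    (Finset.sum_nonneg fun _ _ => add_nonneg (relu_nonneg _) (relu_nonneg _))

/-- Both branches lie in `[0, lam]`, hence so does the absolute value of their difference, the
output. -/
lemma Regime.neg_logisticLoss'_near_half (R : Regime S c₁ c₂ t₂ c θ lam g T)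
    (E : TrainingEvent t₂ θ ω) {t : ℕ} (ht : t ≤ T) (i : Fin S.n) :
    |-logisticLoss' (output ω t i) (obs ω i) - 1 / 2| ≤ lam := by
  refine (abs_neg_logisticLoss'_sub_half_le _ _).trans ?_
  have h1 := R.branch_bound E ht true i
  have h2 := R.branch_bound E ht false i
  have h3 := branch_nonneg (iter ω t) true (input ω i)
  have h4 := branch_nonneg (iter ω t) false (input ω i)
  unfold output network
  rw [abs_le]
  constructor <;> linarith

lemma Basic.card_class (h : S.Basic) (b : Bool) :
    ((Finset.univ.filter fun i => S.y i = b).card : ℝ) = S.n / 2 := by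
  have h1 := h.balanced
  have h2 : (Finset.univ.filter fun i => S.y i = true).card
      + (Finset.univ.filter fun i => S.y i = false).card = S.n := by
    have := Finset.card_filter_add_card_filter_not (s := (Finset.univ : Finset (Fin S.n)))
      (fun i => S.y i = true)
    simpa using this
  have h3 : ((Finset.univ.filter fun i => S.y i = true).card : ℝ)
      + (Finset.univ.filter fun i => S.y i = false).card = S.n := by exact_mod_cast h2
  rw [h1] at h3
  cases b
  · linarith
  · rw [h1]; linarith

/-- A clean sample contributes at least `1/2 - lam`, a noisy one at least `-1/2 - lam`, and at most
a fraction `t₂ + θ` of the class is noisy. -/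
lemma Regime.class_drive_ge (R : Regime S c₁ c₂ t₂ c θ lam g T)
    (E : TrainingEvent t₂ θ ω) {t : ℕ} (ht : t ≤ T) (b : Bool) :
    S.n / 2 * ((1 - 2 * t₂) / 2 - θ - lam) ≤ ∑ i with S.y i = b,
      -logisticLoss' (output ω t i) (obs ω i) * (sgn (S.y i) * sgn (obs ω i)) := by
  have hterm : ∀ i, (1 / 2 - lam) - (if obs ω i ≠ S.y i then (1 : ℝ) else 0)
      ≤ -logisticLoss' (output ω t i) (obs ω i) * (sgn (S.y i) * sgn (obs ω i)) := fun i => by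
    have h1 := abs_le.1 (R.neg_logisticLoss'_near_half E ht i)
    generalize -logisticLoss' (output ω t i) (obs ω i) = q at *
    cases S.y i <;> cases obs ω i <;> simp [sgn] <;> linarith
  refine le_trans ?_ (Finset.sum_le_sum fun i _ => hterm i)
  rw [Finset.sum_sub_distrib, Finset.sum_const, nsmul_eq_mul, R.basic.card_class,
    ← Finset.sum_filter, Finset.filter_filter]
  simp only [Finset.sum_const, nsmul_eq_mul, mul_one]
  linarith [E.noisy_card b]

lemma Regime.gap_drive_ge (R : Regime S c₁ c₂ t₂ c θ lam g T) :
    1 / 2 + g / 2 + θ + lam ≤ c₁ / 2 * ((1 - 2 * t₂) / 2 - θ - lam) := by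
  linarith [R.gap_ge, R.gap_eq]

lemma Regime.lam_nonneg (R : Regime S c₁ c₂ t₂ c θ lam g T) : 0 ≤ lam := by
  rw [R.lam_eq]
  have := R.err_nonneg
  have := R.c_pos
  have : 0 ≤ c₂ + 2 := by linarith [R.two_le, R.c_le]
  positivity

/-- Activity on the signal patch depends only on the class of the sample. Whatever the sign of `⟨w,
μ⟩`, at least one class is active, and the other contributes a nonnegative amount; so no control of
the activation pattern is needed. -/
lemma Regime.signal_drive_ge (R : Regime S c₁ c₂ t₂ c θ lam g T)
    (E : TrainingEvent t₂ θ ω) {t : ℕ} (ht : t ≤ T) (j : Bool) (r : Fin S.m) :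
    S.n / 2 * ((1 - 2 * t₂) / 2 - θ - lam) ≤
      ∑ i, drive ω t i (inner ℝ (iter ω t j r) (sgn (S.y i) • S.mu))
        * (sgn (S.y i) * sgn (obs ω i)) := by
  have hpos : 0 ≤ S.n / 2 * ((1 - 2 * t₂) / 2 - θ - lam) := by
    refine mul_nonneg (by positivity) ?_
    have h1 := R.gap_drive_ge
    have h2 := R.lam_nonneg
    have h3 : 0 < c₁ / 2 * ((1 - 2 * t₂) / 2 - θ - lam) := by
      linarith [R.gap_pos, R.theta_pos]
    exact (pos_of_mul_pos_right h3 (by linarith [R.two_le])).le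
  set z : ℝ := inner ℝ (iter ω t j r) S.mu with hz
  have hsum : ∑ i, drive ω t i (inner ℝ (iter ω t j r) (sgn (S.y i) • S.mu))
        * (sgn (S.y i) * sgn (obs ω i)) = ∑ b, relu' (sgn b * z) * ∑ i with S.y i = b,
      -logisticLoss' (output ω t i) (obs ω i) * (sgn (S.y i) * sgn (obs ω i)) := by
    rw [← Finset.sum_fiberwise Finset.univ S.y]
    refine Finset.sum_congr rfl fun b _ => ?_
    rw [Finset.mul_sum]
    refine Finset.sum_congr rfl fun i hi => ?_
    rw [(Finset.mem_filter.1 hi).2, real_inner_smul_right, drive]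
    ring
  rw [hsum, Fintype.sum_bool]
  have ht := R.class_drive_ge E ht true
  have hf := R.class_drive_ge E ‹t ≤ T› false
  generalize S.n / 2 * ((1 - 2 * t₂) / 2 - θ - lam) = a at *
  rcases le_total 0 z with h | h
  · rw [relu'_of_nonneg (x := sgn true * z) (by simpa [sgn] using h)]
    linarith [mul_nonneg (relu'_nonneg (sgn false * z)) (hpos.trans hf)]
  · rw [relu'_of_nonneg (x := sgn false * z) (by simpa [sgn] using h)]
    linarith [mul_nonneg (relu'_nonneg (sgn true * z)) (hpos.trans ht)]

lemma Regime.gam_ge (R : Regime S c₁ c₂ t₂ c θ lam g T)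
    (E : TrainingEvent t₂ θ ω) {t : ℕ} (ht : t ≤ T) (j : Bool) (r : Fin S.m) :
    t / S.timeScale * (1 / 2 + g / 2 + θ + lam) ≤ gam ω j r t := by
  have hh := R.basic.step_pos
  induction t with
  | zero => simp [gam]
  | succ t ih =>
    have ih := ih (Nat.le_of_succ_le ht)
    rw [gam_succ]
    have h1 : S.timeScale⁻¹ * (1 / 2 + g / 2 + θ + lam) ≤ S.eta / (S.n * S.m) * (‖S.mu‖ ^ 2 *
        ∑ i, drive ω t i (inner ℝ (iter ω t j r) (sgn (S.y i) • S.mu))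
        * (sgn (S.y i) * sgn (obs ω i))) := by
      rw [← R.basic.step_mul_noiseEnergy, mul_assoc]
      refine mul_le_mul_of_nonneg_left ?_ hh.le
      have hq := R.gap_drive_ge
      have hq' : 0 ≤ (1 - 2 * t₂) / 2 - θ - lam := by
        have h3 : 0 < c₁ / 2 * ((1 - 2 * t₂) / 2 - θ - lam) := by
          linarith [R.gap_pos, R.theta_pos, R.lam_nonneg]
        exact (pos_of_mul_pos_right h3 (by linarith [R.two_le])).le
      calc S.noiseEnergy * (1 / 2 + g / 2 + θ + lam)
          ≤ S.noiseEnergy * (c₁ / 2 * ((1 - 2 * t₂) / 2 - θ - lam)) :=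
            mul_le_mul_of_nonneg_left hq R.basic.noiseEnergy_pos.le
        _ = (c₁ * S.noiseEnergy) * (1 / 2 * ((1 - 2 * t₂) / 2 - θ - lam)) := by ring
        _ ≤ (S.n * ‖S.mu‖ ^ 2) * (1 / 2 * ((1 - 2 * t₂) / 2 - θ - lam)) :=
            mul_le_mul_of_nonneg_right R.signal_ge (by linarith)
        _ = ‖S.mu‖ ^ 2 * (S.n / 2 * ((1 - 2 * t₂) / 2 - θ - lam)) := by ring
        _ ≤ _ := mul_le_mul_of_nonneg_left
            (R.signal_drive_ge E (Nat.le_of_succ_le ht) j r) (sq_nonneg _)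
    push_cast
    rw [add_div, one_div, add_mul]
    linarith

lemma Regime.rho_le (R : Regime S c₁ c₂ t₂ c θ lam g T)
    (E : TrainingEvent t₂ θ ω) {t : ℕ} (ht : t ≤ T) (j : Bool) (r : Fin S.m) (i : Fin S.n) :
    rho ω j r i t ≤ t / S.timeScale * (1 / 2 + θ + lam) := by
  have hh := R.basic.step_pos
  have hθ := R.theta_pos
  have hD := R.basic.noiseEnergy_pos
  have hlam := R.lam_nonneg
  induction t with
  | zero => simp [rho]
  | succ t ih =>
    have ih := ih (Nat.le_of_succ_le ht)
    rw [rho_succ]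
    have h1 : S.eta / (S.n * S.m) * (drive ω t i (inner ℝ (iter ω t j r) (xi ω i))
        * (sgn j * sgn (obs ω i)) * ‖xi ω i‖ ^ 2) ≤ S.timeScale⁻¹ * (1 / 2 + θ + lam) := by
      rw [← R.basic.step_mul_noiseEnergy, mul_assoc (S.eta / _)]
      refine mul_le_mul_of_nonneg_left ?_ hh.le
      have hq := (abs_le.1 (R.neg_logisticLoss'_near_half E (Nat.le_of_succ_le ht) i)).2
      have hd : drive ω t i (inner ℝ (iter ω t j r) (xi ω i)) ≤ 1 / 2 + lam := by
        refine (mul_le_of_le_one_right (neg_logisticLoss'_nonneg _ _) (relu'_le_one _)).trans ?_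
        linarith
      have hs : sgn j * sgn (obs ω i) ≤ 1 := (le_abs_self _).trans (abs_sgn_mul_sgn _ _).le
      have hds : drive ω t i (inner ℝ (iter ω t j r) (xi ω i)) * (sgn j * sgn (obs ω i))
          ≤ 1 / 2 + lam :=
        (mul_le_of_le_one_right (drive_nonneg _ _ _ _) hs).trans hd
      calc _ ≤ (1 / 2 + lam) * ‖xi ω i‖ ^ 2 := by gcongr
        _ ≤ (1 / 2 + lam) * ((1 + θ) * S.noiseEnergy) := by
          gcongr
          exact E.norm_sq_xi_le i
        _ = S.noiseEnergy * ((1 / 2 + lam) * (1 + θ)) := by ring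
        _ ≤ _ := by
          gcongr
          -- The product `(1/2 + lam)(1 + θ)` exceeds `1/2 + lam` by `θ(1/2 + lam) ≤ θ`.
          nlinarith [R.lam_le]
    push_cast
    rw [add_div, one_div, add_mul]
    linarith

lemma Regime.norm_sq_xi_pos (R : Regime S c₁ c₂ t₂ c θ lam g T) (E : TrainingEvent t₂ θ ω)
    (i : Fin S.n) : 0 < ‖xi ω i‖ ^ 2 := by
  linarith [R.half_le_norm_sq_xi E i, R.basic.noiseEnergy_pos]

/-- An exact increment is needed to propagate activity: the approximation of the inner product by
`ρ` has an error that could hide its sign early in training, when `ρ` is still tiny. -/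
lemma Regime.inner_xi_iter_succ (R : Regime S c₁ c₂ t₂ c θ lam g T) (E : TrainingEvent t₂ θ ω)
    (t : ℕ) (j : Bool) (r : Fin S.m) (i : Fin S.n) :
    (inner ℝ (xi ω i) (iter ω (t + 1) j r) : ℝ) = inner ℝ (xi ω i) (iter ω t j r)
      + S.eta / (S.n * S.m) *
        (sgn j * (∑ i, drive ω t i (inner ℝ (iter ω t j r) (sgn (S.y i) • S.mu))
          * (sgn (S.y i) * sgn (obs ω i))) * inner ℝ (xi ω i) S.mu
        + ∑ k, drive ω t k (inner ℝ (iter ω t j r) (xi ω k)) * (sgn j * sgn (obs ω k))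
          * inner ℝ (xi ω i) (xi ω k)) := by
  have hM := R.norm_mu_sq_pos
  rw [inner_iter ω (t + 1), inner_iter ω t, gam_succ]
  have h : ∀ k, rho ω j r k (t + 1) * (‖xi ω k‖ ^ 2)⁻¹ * (inner ℝ (xi ω i) (xi ω k) : ℝ)
      = rho ω j r k t * (‖xi ω k‖ ^ 2)⁻¹ * inner ℝ (xi ω i) (xi ω k)
        + S.eta / (S.n * S.m) * (drive ω t k (inner ℝ (iter ω t j r) (xi ω k))
          * (sgn j * sgn (obs ω k)) * inner ℝ (xi ω i) (xi ω k)) := fun k => by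
    have hk := (R.norm_sq_xi_pos E k).ne'
    rw [rho_succ, add_mul, add_mul]
    congr 1
    generalize ‖xi ω k‖ ^ 2 = a at *
    field_simp
  simp_rw [h]
  rw [Finset.sum_add_distrib, ← Finset.mul_sum]
  have hM' := mul_inv_cancel₀ hM.ne'
  generalize (‖S.mu‖ ^ 2)⁻¹ = a at *
  generalize ‖S.mu‖ ^ 2 = b at *
  linear_combination (sgn j * (S.eta / (S.n * S.m)) * (∑ i, drive ω t i
    (inner ℝ (iter ω t j r) (sgn (S.y i) • S.mu)) * (sgn (S.y i) * sgn (obs ω i)))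
      * inner ℝ (xi ω i) S.mu) * hM'

/-- An active sample pushes its own inner product up by at least `(1 - θ)D/4` times the step, while
the signal and the other samples push it down by at most `θD` each; `θ ≤ 1/16` decides. -/
lemma Regime.active_succ (R : Regime S c₁ c₂ t₂ c θ lam g T) (E : TrainingEvent t₂ θ ω)
    {t : ℕ} (ht : t ≤ T) (i : Fin S.n) (r : Fin S.m)
    (h : 0 ≤ (inner ℝ (iter ω t (obs ω i) r) (xi ω i) : ℝ)) :
    0 ≤ (inner ℝ (iter ω (t + 1) (obs ω i) r) (xi ω i) : ℝ) := by
  have hD := R.basic.noiseEnergy_pos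
  have hn : (0 : ℝ) < S.n := by exact_mod_cast R.basic.n_pos
  have hh := R.basic.step_pos
  rw [real_inner_comm] at h ⊢
  rw [R.inner_xi_iter_succ E]
  refine add_nonneg h (mul_nonneg hh.le ?_)
  rw [← Finset.add_sum_erase _ (fun k => drive ω t k (inner ℝ (iter ω t (obs ω i) r) (xi ω k))
    * (sgn (obs ω i) * sgn (obs ω k)) * inner ℝ (xi ω i) (xi ω k)) (Finset.mem_univ i)]
  have h1 : |sgn (obs ω i) * (∑ k, drive ω t k
      (inner ℝ (iter ω t (obs ω i) r) (sgn (S.y k) • S.mu)) * (sgn (S.y k) * sgn (obs ω k)))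
        * inner ℝ (xi ω i) S.mu| ≤ θ * S.noiseEnergy := by
    rw [abs_mul, abs_mul, abs_sgn, one_mul, real_inner_comm]
    calc _ ≤ (S.n : ℝ) * (θ * (S.noiseEnergy / S.n)) := by
          gcongr
          · exact abs_signal_drive_le _ _ _ _
          · exact E.inner_mu i
      _ = _ := by field_simp
  have h2 : |∑ k ∈ Finset.univ.erase i, drive ω t k (inner ℝ (iter ω t (obs ω i) r) (xi ω k))
      * (sgn (obs ω i) * sgn (obs ω k)) * inner ℝ (xi ω i) (xi ω k)| ≤ θ * S.noiseEnergy := by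
    refine (Finset.abs_sum_le_sum_abs _ _).trans ?_
    refine (Finset.sum_le_card_nsmul _ _ (θ * (S.noiseEnergy / S.n)) fun k hk => ?_).trans ?_
    · rw [abs_mul, abs_mul, abs_sgn_mul_sgn, mul_one]
      exact (mul_le_of_le_one_left (abs_nonneg _) (abs_drive_le_one _ _ _ _)).trans
        (E.inner_xi i k (Finset.ne_of_mem_erase hk).symm)
    · rw [nsmul_eq_mul]
      have := R.theta_pos
      calc _ ≤ (S.n : ℝ) * (θ * (S.noiseEnergy / S.n)) := by
            gcongr
            exact (Finset.card_le_univ _).trans (by simp)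
        _ = _ := by field_simp
  have h3 : 1 / 4 * ((1 - θ) * S.noiseEnergy) ≤
      drive ω t i (inner ℝ (iter ω t (obs ω i) r) (xi ω i)) * (sgn (obs ω i) * sgn (obs ω i))
        * inner ℝ (xi ω i) (xi ω i) := by
    rw [sgn_mul_self, mul_one, real_inner_self_eq_norm_sq]
    have hq := (abs_le.1 (R.neg_logisticLoss'_near_half E ht i)).1
    have := R.theta_le
    have hd : 1 / 4 ≤ drive ω t i (inner ℝ (iter ω t (obs ω i) r) (xi ω i)) := by
      rw [drive, real_inner_comm, relu'_of_nonneg h]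
      linarith [R.lam_le]
    exact mul_le_mul hd (E.le_norm_sq_xi i) (mul_nonneg (by linarith) hD.le) (by linarith)
  have h4 := (abs_le.1 h1).1
  have h5 := (abs_le.1 h2).1
  nlinarith [R.theta_le]

lemma Regime.active (R : Regime S c₁ c₂ t₂ c θ lam g T) (E : TrainingEvent t₂ θ ω)
    {t : ℕ} (ht : t ≤ T) (i : Fin S.n) (r : Fin S.m)
    (h : 0 ≤ (inner ℝ (iter ω 0 (obs ω i) r) (xi ω i) : ℝ)) :
    0 ≤ (inner ℝ (iter ω t (obs ω i) r) (xi ω i) : ℝ) := by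
  induction t with
  | zero => exact h
  | succ t ih => exact R.active_succ E (Nat.le_of_succ_le ht) i r (ih (Nat.le_of_succ_le ht))

/-- Persistent activity removes the factor `σ'`, leaving a drive of at least 1/4 against `‖ξ_i‖² ≥
D/2`. -/
lemma Regime.le_rho (R : Regime S c₁ c₂ t₂ c θ lam g T) (E : TrainingEvent t₂ θ ω)
    {t : ℕ} (ht : t ≤ T) (i : Fin S.n) (r : Fin S.m)
    (h : 0 ≤ (inner ℝ (iter ω 0 (obs ω i) r) (xi ω i) : ℝ)) :
    t / S.timeScale * (1 / 8) ≤ rho ω (obs ω i) r i t := by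
  have hh := R.basic.step_pos
  have hD := R.basic.noiseEnergy_pos
  induction t with
  | zero => simp [rho]
  | succ t ih =>
    have ih := ih (Nat.le_of_succ_le ht)
    rw [rho_succ]
    have h1 : S.timeScale⁻¹ * (1 / 8) ≤ S.eta / (S.n * S.m) *
        (drive ω t i (inner ℝ (iter ω t (obs ω i) r) (xi ω i))
          * (sgn (obs ω i) * sgn (obs ω i)) * ‖xi ω i‖ ^ 2) := by
      rw [← R.basic.step_mul_noiseEnergy, mul_assoc (S.eta / _)]
      refine mul_le_mul_of_nonneg_left ?_ hh.le
      have hq := (abs_le.1 (R.neg_logisticLoss'_near_half E (Nat.le_of_succ_le ht) i)).1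
      rw [drive, relu'_of_nonneg (R.active E (Nat.le_of_succ_le ht) i r h), sgn_mul_self,
        mul_one, mul_one]
      calc S.noiseEnergy * (1 / 8) = 1 / 4 * (S.noiseEnergy / 2) := by ring
        _ ≤ _ := mul_le_mul (by linarith [R.lam_le]) (R.half_le_norm_sq_xi E i) (by positivity)
            (by linarith [R.lam_le])
    push_cast
    rw [add_div, one_div, add_mul]
    linarith

lemma rho_nonpos_of_ne (hS : S.Basic) (ω : S.Outcome) {j : Bool} {i : Fin S.n}
    (hj : j ≠ obs ω i) (r : Fin S.m) (t : ℕ) : rho ω j r i t ≤ 0 := by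
  have hs : sgn j * sgn (obs ω i) = -1 := by
    revert hj
    cases j <;> cases obs ω i <;> simp [sgn]
  induction t with
  | zero => simp [rho]
  | succ t ih =>
    rw [rho_succ, hs]
    have h1 := mul_nonneg hS.step_pos.le (mul_nonneg
      (drive_nonneg ω t i (inner ℝ (iter ω t j r) (xi ω i))) (sq_nonneg ‖xi ω i‖))
    linarith

/-! ### Predictions at the end of the stage -/

/-- At the end of the stage every signal coefficient exceeds the common upper bound of the noise
coefficients. -/
lemma Regime.gam_ge_end (R : Regime S c₁ c₂ t₂ c θ lam g T) (E : TrainingEvent t₂ θ ω)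
    (j : Bool) (r : Fin S.m) :
    T / S.timeScale * (1 / 2 + θ + lam) + c * g / 2 ≤ gam ω j r T := by
  have h := R.gam_ge E le_rfl j r
  have h2 : c * (g / 2) ≤ T / S.timeScale * (g / 2) :=
    mul_le_mul_of_nonneg_right R.time_ge (by linarith [R.gap_pos])
  linarith

lemma Regime.rho_bound_nonneg (R : Regime S c₁ c₂ t₂ c θ lam g T) :
    0 ≤ T / S.timeScale * (1 / 2 + θ + lam) := by
  have := R.time_ge
  have := R.c_pos
  have := R.theta_pos
  have := R.lam_nonneg
  exact mul_nonneg (by linarith) (by linarith)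

lemma Regime.rhoBar_le (R : Regime S c₁ c₂ t₂ c θ lam g T) (E : TrainingEvent t₂ θ ω)
    (j : Bool) (r : Fin S.m) (i : Fin S.n) :
    rhoBar ω j r i T ≤ T / S.timeScale * (1 / 2 + θ + lam) := by
  unfold rhoBar
  split_ifs
  · exact R.rho_le E le_rfl j r i
  · exact R.rho_bound_nonneg

lemma Regime.inner_signal (R : Regime S c₁ c₂ t₂ c θ lam g T) (E : TrainingEvent t₂ θ ω)
    (b j : Bool) (r : Fin S.m) :
    |(inner ℝ (iter ω T j r) (sgn b • S.mu) : ℝ) - sgn b * sgn j * gam ω j r T|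
      ≤ θ * (c₂ + 5) := by
  rw [real_inner_smul_right, real_inner_comm, mul_assoc, ← mul_sub, abs_mul, abs_sgn, one_mul]
  exact R.inner_mu_iter E le_rfl j r

/-- The branch of the sign of the signal patch responds with the signal coefficient. -/
lemma Regime.le_branch_same (R : Regime S c₁ c₂ t₂ c θ lam g T) (E : TrainingEvent t₂ θ ω)
    (b : Bool) (v : Vec S.d) :
    T / S.timeScale * (1 / 2 + θ + lam) + c * g / 2 - θ * (c₂ + 5)
      ≤ branch (iter ω T) b (sgn b • S.mu, v) := by
  refine le_branch R.basic.m_pos fun r => ?_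
  have h1 := (abs_le.1 (R.inner_signal E b b r)).1
  rw [sgn_mul_self, one_mul] at h1
  have h2 := R.gam_ge_end E b r
  have h3 := le_relu (inner ℝ (iter ω T b r) (sgn b • S.mu))
  have h4 := relu_nonneg (inner ℝ (iter ω T b r) v)
  simp only
  linarith

/-- The other branch only responds to the noise patch. -/
lemma Regime.branch_other_le (R : Regime S c₁ c₂ t₂ c θ lam g T) (E : TrainingEvent t₂ θ ω)
    {b j : Bool} (hj : j ≠ b) {v : Vec S.d} {a : ℝ} (ha : 0 ≤ a)
    (hv : ∀ r, (inner ℝ (iter ω T j r) v : ℝ) ≤ a) :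
    branch (iter ω T) j (sgn b • S.mu, v) ≤ θ * (c₂ + 5) + a := by
  refine branch_le R.basic.m_pos fun r => add_le_add ?_ (relu_le ha (hv r))
  refine relu_le R.err_nonneg ?_
  have h1 := (abs_le.1 (R.inner_signal E b j r)).2
  have hs : sgn b * sgn j = -1 := by
    revert hj
    cases j <;> cases b <;> simp [sgn]
  rw [hs] at h1
  have h2 := R.gam_ge_end E j r
  have h3 := mul_pos R.c_pos R.gap_pos
  have h4 := R.rho_bound_nonneg
  simp only
  linarith

/-- For a clean sample, signal and label agree, and the opposing branch has nonpositive noise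
coefficients; it therefore responds only with error terms. -/
lemma Regime.clean_fit (R : Regime S c₁ c₂ t₂ c θ lam g T) (E : TrainingEvent t₂ θ ω)
    {i : Fin S.n} (hi : IsClean ω i) : 0 ≤ sgn (obs ω i) * output ω T i := by
  rw [output, sgn_mul_network, input, ← show obs ω i = S.y i from hi]
  have h1 := R.le_branch_same E (obs ω i) (xi ω i)
  have hne : (!obs ω i) ≠ obs ω i := by simp
  have h2 := R.branch_other_le E hne (v := xi ω i) R.err_nonneg fun r => by
    have h3 := (abs_le.1 (R.inner_xi_iter E le_rfl (!obs ω i) r i)).2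
    rw [real_inner_comm]
    linarith [rho_nonpos_of_ne R.basic ω hne r T]
  linarith [R.rho_bound_nonneg, R.err_le, R.err_nonneg]

/-- Here the branch of the observed label has memorized `ξ_i`, and the branch of the true label
responds to the signal. The gap `cg/2` makes the latter win. -/
lemma Regime.noisy_unfit (R : Regime S c₁ c₂ t₂ c θ lam g T) (E : TrainingEvent t₂ θ ω)
    {i : Fin S.n} (hi : ¬ IsClean ω i) : sgn (obs ω i) * output ω T i ≤ 0 := by
  have hne : obs ω i ≠ S.y i := hi
  have hy : (!obs ω i) = S.y i := by
    revert hne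
    cases obs ω i <;> cases S.y i <;> simp
  rw [output, sgn_mul_network, input, hy]
  have h1 := R.le_branch_same E (S.y i) (xi ω i)
  have h2 := R.branch_other_le E hne (v := xi ω i)
    (add_nonneg R.rho_bound_nonneg R.err_nonneg) fun r => by
      have h3 := (abs_le.1 (R.inner_xi_iter E le_rfl (obs ω i) r i)).2
      rw [real_inner_comm]
      linarith [R.rho_le E le_rfl (obs ω i) r i]
  linarith [R.err_le, R.err_nonneg]

/-- The worst case is a reused patch `ξ_i` memorized in favour of the wrong label. The gap `cg/2`
still covers the `cg/8` of fresh noise and three error terms `θ(c₂ + 5)`. -/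
lemma Regime.test_correct (R : Regime S c₁ c₂ t₂ c θ lam g T) (E : TrainingEvent t₂ θ ω)
    (b : Bool) (i : Fin S.n) {ζ : Vec S.d}
    (hζ : ∀ j r, (inner ℝ (iter ω T j r) ζ : ℝ) ≤ c * g / 8) :
    0 ≤ sgn b * network (iter ω T) (sgn b • S.mu, xi ω i + ζ) := by
  rw [sgn_mul_network]
  have hcg := mul_pos R.c_pos R.gap_pos
  have h1 := R.le_branch_same E b (xi ω i + ζ)
  have h2 := R.branch_other_le E (b := b) (j := !b) (by simp) (v := xi ω i + ζ)
    (a := T / S.timeScale * (1 / 2 + θ + lam) + θ * (c₂ + 5) + c * g / 8)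
    (by linarith [R.rho_bound_nonneg, R.err_nonneg]) fun r => by
      have h3 := (abs_le.1 (R.inner_xi_iter E le_rfl (!b) r i)).2
      rw [inner_add_right, real_inner_comm]
      linarith [R.rho_le E le_rfl (!b) r i, hζ (!b) r]
  linarith [R.err_le]

lemma Regime.isStageOneEnd (R : Regime S c₁ c₂ t₂ c θ lam g T) (E : TrainingEvent t₂ θ ω) :
    IsStageOneEnd (c / 8) (c₂ + 2) ω T where
  rho_order i r h := by
    have hρ := R.le_rho E le_rfl i r h
    have h1 : c / 8 ≤ rho ω (obs ω i) r i T := by linarith [R.time_ge]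
    have h2 := (abs_le.1 (R.abs_rho_le E (obs ω i) r i T)).2
    rw [rhoBar, if_pos (by linarith [R.c_pos])]
    exact ⟨h1, by linarith [R.time_le, R.c_le_half, R.two_le, R.c_le]⟩
  gam_order j r := by
    have h1 := R.gam_ge_end E j r
    have h2 := (abs_le.1 (R.abs_gam_le ω j r T)).2
    have h3 : c * (1 / 2) ≤ T / S.timeScale * (1 / 2 + θ + lam) :=
      mul_le_mul R.time_ge (by linarith [R.theta_pos, R.lam_nonneg]) (by norm_num)
        (by linarith [R.time_ge, R.c_pos])
    have h4 : c₂ * (T / S.timeScale) ≤ c₂ * 1 :=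
      mul_le_mul_of_nonneg_left (by linarith [R.time_le, R.c_le_half])
        (by linarith [R.two_le, R.c_le])
    exact ⟨by linarith [mul_pos R.c_pos R.gap_pos, R.c_pos], by linarith⟩
  signal_dominates j r i := by
    linarith [R.rhoBar_le E (obs ω i) r i, R.gam_ge_end E j r, mul_pos R.c_pos R.gap_pos]
  clean_fit _ hi := R.clean_fit E hi
  noisy_unfit _ hi := R.noisy_unfit E hi

/-- The Gram matrix is nearly diagonal: the `n` diagonal entries are about `D`, and the `n²` others,
of size `θD/n`, have total at most `θnD`. The coefficients are at most `4/D`. -/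
lemma Regime.norm_sq_noise_part_le (R : Regime S c₁ c₂ t₂ c θ lam g T)
    (E : TrainingEvent t₂ θ ω) (j : Bool) (r : Fin S.m) :
    ‖∑ k, (rho ω j r k T * (‖xi ω k‖ ^ 2)⁻¹) • xi ω k‖ ^ 2 ≤ 32 * (S.n / S.noiseEnergy) := by
  have hD := R.basic.noiseEnergy_pos
  have hn : (0 : ℝ) < S.n := by exact_mod_cast R.basic.n_pos
  have hθ := R.theta_pos
  have hθ' := R.theta_le
  have ha : ∀ k, |rho ω j r k T * (‖xi ω k‖ ^ 2)⁻¹| ≤ 4 / S.noiseEnergy := fun k => by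
    have h1 : |rho ω j r k T| ≤ 2 := by
      linarith [R.abs_rho_le E j r k T, R.time_le, R.c_le_half]
    have h2 := R.half_le_norm_sq_xi E k
    rw [abs_mul, abs_of_nonneg (a := (‖xi ω k‖ ^ 2)⁻¹) (by positivity)]
    calc _ ≤ 2 * (S.noiseEnergy / 2)⁻¹ := by gcongr
      _ = _ := by field_simp; norm_num
  have hz : ∀ k l, |(inner ℝ (xi ω k) (xi ω l) : ℝ)| ≤
      (if k = l then (1 + θ) * S.noiseEnergy else 0) + θ * (S.noiseEnergy / S.n) := fun k l => by
    split_ifs with hkl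
    · subst hkl
      rw [real_inner_self_eq_norm_sq, abs_of_nonneg (sq_nonneg _)]
      have : 0 ≤ θ * (S.noiseEnergy / S.n) := by positivity
      linarith [E.norm_sq_xi_le k]
    · linarith [E.inner_xi k l hkl]
  rw [← real_inner_self_eq_norm_sq, sum_inner]
  simp only [inner_sum, real_inner_smul_left, real_inner_smul_right]
  calc _ ≤ ∑ k : Fin S.n, ∑ l : Fin S.n, 4 / S.noiseEnergy * (4 / S.noiseEnergy *
        ((if k = l then (1 + θ) * S.noiseEnergy else 0) + θ * (S.noiseEnergy / S.n))) := by
        refine Finset.sum_le_sum fun k _ => Finset.sum_le_sum fun l _ => (le_abs_self _).trans ?_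
        rw [abs_mul]
        refine mul_le_mul (ha l) ?_ (abs_nonneg _) (by positivity)
        rw [abs_mul]
        exact mul_le_mul (ha k) (hz k l) (abs_nonneg _) (by positivity)
    _ = 16 * (1 + 2 * θ) * (S.n / S.noiseEnergy) := by
        simp only [← Finset.mul_sum, Finset.sum_add_distrib, Finset.sum_ite_eq, Finset.mem_univ,
          if_true, Finset.sum_const, Finset.card_univ, Fintype.card_fin, nsmul_eq_mul]
        field_simp
        ring
    _ ≤ _ := by
        gcongr
        linarith

/-- This bounds the variance of a neuron's response to fresh noise. Initialization, signal and noise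
parts contribute 2, `c₂²` and 32 to the constant, and the factor 3 comes from squaring a sum of
three vectors. -/
lemma Regime.weight_norm_sq_le (R : Regime S c₁ c₂ t₂ c θ lam g T)
    (E : TrainingEvent t₂ θ ω) (hσ : S.sigma0 ^ 2 * S.noiseEnergy ≤ S.n / S.d)
    (j : Bool) (r : Fin S.m) :
    S.sigmaXi ^ 2 * ‖iter ω T j r‖ ^ 2 ≤ 3 * (34 + c₂ ^ 2) * (S.n / S.d) := by
  have hD := R.basic.noiseEnergy_pos
  have hM := R.norm_mu_sq_pos
  have hσξ := R.basic.sigmaXi_pos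
  have hn : (0 : ℝ) < S.n := by exact_mod_cast R.basic.n_pos
  have hd : (0 : ℝ) < S.d := by exact_mod_cast R.basic.d_pos
  have hγ : |gam ω j r T| ≤ c₂ := by
    have := R.abs_gam_le ω j r T
    have h5 : T / S.timeScale ≤ 1 := by linarith [R.time_le, R.c_le_half]
    nlinarith [R.two_le, R.c_le]
  have h1 : ‖(sgn j * gam ω j r T * (‖S.mu‖ ^ 2)⁻¹) • S.mu‖ ^ 2
      ≤ c₂ ^ 2 * (S.n / S.noiseEnergy) := by
    have h2 : (‖S.mu‖ ^ 2)⁻¹ ≤ S.n / S.noiseEnergy := by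
      rw [inv_le_iff_one_le_mul₀ hM, div_mul_eq_mul_div, le_div_iff₀ hD]
      nlinarith [R.signal_ge, R.two_le]
    have h3 : gam ω j r T ^ 2 ≤ c₂ ^ 2 := sq_le_sq' (by linarith [abs_le.1 hγ]) (abs_le.1 hγ).2
    rw [norm_smul, mul_pow, Real.norm_eq_abs, sq_abs]
    calc _ = (sgn j * sgn j) * gam ω j r T ^ 2 * (‖S.mu‖ ^ 2)⁻¹ := by
          rw [mul_pow, mul_assoc, pow_two (‖S.mu‖ ^ 2)⁻¹, inv_mul_cancel_right₀ hM.ne']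
          ring
      _ ≤ _ := by
          rw [sgn_mul_self, one_mul]
          gcongr
  have h2 := R.norm_sq_noise_part_le E j r
  have h3 := E.init_norm j r
  have key : ∀ u v w : Vec S.d, ‖u + v + w‖ ^ 2 ≤ 3 * (‖u‖ ^ 2 + ‖v‖ ^ 2 + ‖w‖ ^ 2) :=
    fun u v w => by
      have h := norm_add₃_le (a := u) (b := v) (c := w)
      have h' : ‖u + v + w‖ ^ 2 ≤ (‖u‖ + ‖v‖ + ‖w‖) ^ 2 := by gcongr
      nlinarith [sq_nonneg (‖u‖ - ‖v‖), sq_nonneg (‖u‖ - ‖w‖), sq_nonneg (‖v‖ - ‖w‖)]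
  have h4 : S.sigmaXi ^ 2 * (S.n / S.noiseEnergy) = S.n / S.d := by
    unfold noiseEnergy
    field_simp
  have h5 : S.sigmaXi ^ 2 * (S.sigma0 ^ 2 * S.d) ≤ S.n / S.d := by
    refine le_trans (le_of_eq ?_) hσ
    unfold noiseEnergy
    ring
  rw [signal_noise_decomposition]
  calc _ ≤ S.sigmaXi ^ 2 * (3 * (2 * (S.sigma0 ^ 2 * S.d) + c₂ ^ 2 * (S.n / S.noiseEnergy)
        + 32 * (S.n / S.noiseEnergy))) := by
        refine mul_le_mul_of_nonneg_left ((key _ _ _).trans ?_) (sq_nonneg _)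
        linarith
    _ = 3 * (2 * (S.sigmaXi ^ 2 * (S.sigma0 ^ 2 * S.d))
        + (c₂ ^ 2 + 32) * (S.sigmaXi ^ 2 * (S.n / S.noiseEnergy))) := by ring
    _ ≤ 3 * (2 * (S.n / S.d) + (c₂ ^ 2 + 32) * (S.n / S.d)) := by
        rw [h4]
        linarith
    _ = _ := by ring

end Setup

/-! ### Probabilities of the individual bad events, and the test error -/

lemma measureReal_exists_le {α ι : Type*} [MeasurableSpace α] [Fintype ι] (μ : Measure α)
    {P : ι → α → Prop} {N q : ℝ} (hN : Fintype.card ι = N)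
    (h : ∀ i, μ.real {x | P i x} ≤ q) : μ.real {x | ∃ i, P i x} ≤ N * q := by
  rw [Set.ofPred_exists, ← hN]
  refine (measureReal_iUnion_fintype_le _).trans ?_
  exact (Finset.sum_le_card_nsmul _ _ q fun i _ => h i).trans (by simp)

lemma measurePreserving_eval_pair {ι α : Type*} [Fintype ι] [MeasurableSpace α]
    (μ : ι → Measure α) [∀ i, IsProbabilityMeasure (μ i)] {i k : ι} (hik : i ≠ k) :
    MeasurePreserving (fun x : ι → α => (x i, x k)) (Measure.pi μ) ((μ i).prod (μ k)) := by
  refine ⟨by fun_prop, ?_⟩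
  have h := (iIndepFun_pi (μ := μ) (X := fun _ x => x) fun _ => aemeasurable_id).indepFun hik
  rw [indepFun_iff_map_prod_eq_prod_map_map (measurePreserving_eval μ i).measurable.aemeasurable
    (measurePreserving_eval μ k).measurable.aemeasurable] at h
  have h' := h
  rw [(measurePreserving_eval μ i).map_eq, (measurePreserving_eval μ k).map_eq] at h'
  exact h'

lemma measurable_sgn : Measurable sgn := measurable_of_countable _

lemma continuous_relu : Continuous relu := continuous_const.max continuous_id

lemma measurable_network {m d : ℕ} (W : Weights m d) : Measurable (network W) := by
  have h : Continuous (network W) := by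
    have := continuous_relu
    unfold network branch
    fun_prop
  exact h.measurable

namespace Setup

variable {S : Setup} {ω : S.Outcome}

lemma isProbabilityMeasure_labelLaw {b : Bool} (h₀ : 0 ≤ S.tau b) (h₁ : S.tau b ≤ 1) :
    IsProbabilityMeasure (S.labelLaw b) := by
  refine ⟨?_⟩
  simp only [labelLaw, Measure.add_apply, Measure.smul_apply, measure_univ, smul_eq_mul, mul_one]
  rw [← ENNReal.ofReal_add h₀ (by linarith)]
  simp

lemma integral_noisy_labelLaw {b : Bool} (h₀ : 0 ≤ S.tau b) :
    ∫ x, (if x ≠ b then (1 : ℝ) else 0) ∂(S.labelLaw b) = S.tau b := by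
  rw [labelLaw, integral_add_measure, integral_smul_measure, integral_smul_measure,
    integral_dirac, integral_dirac]
  · simp [ENNReal.toReal_ofReal h₀]
  · exact (integrable_dirac (by simp)).smul_measure (by simp)
  · exact (integrable_dirac (by simp)).smul_measure (by simp)

/-- Hoeffding's bound for the number of noisy samples of a class. -/
lemma Basic.noisy_card_gt_le (hS : S.Basic) (hτ : ∀ b, S.tau b ∈ Set.Icc 0 1)
    {t₂ θ : ℝ} (hτ₂ : ∀ b, S.tau b ≤ t₂) (hθ : 0 ≤ θ) (b : Bool) :
    (Measure.pi fun i : Fin S.n => S.labelLaw (S.y i)).real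
      {l | (t₂ + θ) * (S.n / 2)
        < ((Finset.univ.filter fun i => S.y i = b ∧ l i ≠ S.y i).card : ℝ)}
      ≤ Real.exp (-(θ ^ 2 * S.n)) := by
  have := fun b => isProbabilityMeasure_labelLaw (hτ b).1 (hτ b).2
  have hn : (0 : ℝ) < S.n := by exact_mod_cast hS.n_pos
  set P := Measure.pi fun i : Fin S.n => S.labelLaw (S.y i) with hP
  let X : (i : Fin S.n) → Bool → ℝ := fun i x => if x ≠ S.y i then 1 else 0
  have hX : ∀ i, Measurable (X i) := fun i => measurable_of_countable _
  have hint : ∀ i, ∫ l, X i (l i) ∂P = S.tau (S.y i) := fun i => by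
    exact (integral_comp_eval (μ := fun i : Fin S.n => S.labelLaw (S.y i)) (f := X i)
      (hX i).aestronglyMeasurable).trans (integral_noisy_labelLaw (hτ _).1)
  have hsub : ∀ i, HasSubgaussianMGF (fun l => X i (l i) - S.tau (S.y i))
      ((‖(1 : ℝ) - 0‖₊ / 2) ^ 2) P := fun i => by
    rw [← hint i]
    refine hasSubgaussianMGF_of_mem_Icc
      ((hX i).comp (measurable_pi_apply i)).aemeasurable (ae_of_all _ fun l => ?_)
    simp only [X]
    split_ifs <;> simp
  have hind : iIndepFun (fun i l => X i (l i) - S.tau (S.y i)) P :=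
    iIndepFun_pi (X := fun i x => X i x - S.tau (S.y i)) fun i => by fun_prop
  -- There are `n/2` indicators, each sub-Gaussian with parameter 1/4, so a deviation of `θn/2` has
  -- exponent `(θn/2)² / (n/4) = θ²n`.
  have h := HasSubgaussianMGF.measure_sum_ge_le_of_iIndepFun hind
    (s := Finset.univ.filter fun i => S.y i = b) (fun i _ => hsub i)
    (ε := θ * (S.n / 2)) (by positivity)
  refine le_trans (measureReal_mono fun l hl => ?_) (h.trans (le_of_eq ?_))
  · simp only [Set.mem_ofPred_eq] at hl ⊢
    have h1 : ∑ i with S.y i = b, (X i (l i) - S.tau (S.y i))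
        = ((Finset.univ.filter fun i => S.y i = b ∧ l i ≠ S.y i).card : ℝ)
          - S.n / 2 * S.tau b := by
      rw [Finset.sum_sub_distrib, ← hS.card_class b, ← nsmul_eq_mul, ← Finset.sum_const]
      congr 1
      · simp only [X]
        rw [← Finset.sum_filter, Finset.filter_filter]
        simp
      · exact Finset.sum_congr rfl fun i hi => by rw [(Finset.mem_filter.1 hi).2]
    rw [h1]
    nlinarith [hτ₂ b]
  · congr 1
    simp only [Finset.sum_const, nsmul_eq_mul]
    push_cast
    rw [hS.card_class b]
    simp
    field_simp

lemma isProbabilityMeasure_law (hτ : ∀ b, S.tau b ∈ Set.Icc 0 1) :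
    IsProbabilityMeasure S.law := by
  have := fun b => isProbabilityMeasure_labelLaw (hτ b).1 (hτ b).2
  unfold law
  infer_instance

lemma measurePreserving_labels (hτ : ∀ b, S.tau b ∈ Set.Icc 0 1) :
    MeasurePreserving (fun ω : S.Outcome => ω.1) S.law
      (Measure.pi fun i : Fin S.n => S.labelLaw (S.y i)) := by
  have := fun b => isProbabilityMeasure_labelLaw (hτ b).1 (hτ b).2
  exact measurePreserving_fst

lemma measurePreserving_features (hτ : ∀ b, S.tau b ∈ Set.Icc 0 1) :
    MeasurePreserving (fun ω : S.Outcome => ω.2) S.law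
      ((Measure.pi fun _ : Fin S.n => gaussianVec S.d S.sigmaXi).prod
      (Measure.pi fun _ : Bool => Measure.pi fun _ : Fin S.m => gaussianVec S.d S.sigma0)) := by
  have := fun b => isProbabilityMeasure_labelLaw (hτ b).1 (hτ b).2
  exact measurePreserving_snd

lemma measurePreserving_weight (S : Setup) (j : Bool) (r : Fin S.m) :
    MeasurePreserving (fun W : Weights S.m S.d => W j r)
      (Measure.pi fun _ : Bool => Measure.pi fun _ : Fin S.m => gaussianVec S.d S.sigma0)
      (gaussianVec S.d S.sigma0) :=
  (measurePreserving_eval (fun _ : Fin S.m => gaussianVec S.d S.sigma0) r).comp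
    (measurePreserving_eval
      (fun _ : Bool => Measure.pi fun _ : Fin S.m => gaussianVec S.d S.sigma0) j)

lemma measurePreserving_xi (hτ : ∀ b, S.tau b ∈ Set.Icc 0 1) (i : Fin S.n) :
    MeasurePreserving (fun ω : S.Outcome => xi ω i) S.law (gaussianVec S.d S.sigmaXi) :=
  (measurePreserving_eval (fun _ : Fin S.n => gaussianVec S.d S.sigmaXi) i).comp
    (measurePreserving_fst.comp (measurePreserving_features hτ))

lemma measurePreserving_xi_pair (hτ : ∀ b, S.tau b ∈ Set.Icc 0 1) {i k : Fin S.n} (hik : i ≠ k) :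
    MeasurePreserving (fun ω : S.Outcome => (xi ω i, xi ω k)) S.law
      ((gaussianVec S.d S.sigmaXi).prod (gaussianVec S.d S.sigmaXi)) :=
  (measurePreserving_eval_pair (fun _ : Fin S.n => gaussianVec S.d S.sigmaXi) hik).comp
    (measurePreserving_fst.comp (measurePreserving_features hτ))

lemma measurePreserving_init (hτ : ∀ b, S.tau b ∈ Set.Icc 0 1) (j : Bool) (r : Fin S.m) :
    MeasurePreserving (fun ω : S.Outcome => iter ω 0 j r) S.law (gaussianVec S.d S.sigma0) :=
  (measurePreserving_weight S j r).comp
    (measurePreserving_snd.comp (measurePreserving_features hτ))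

lemma measurePreserving_xi_init (hτ : ∀ b, S.tau b ∈ Set.Icc 0 1) (i : Fin S.n) (j : Bool)
    (r : Fin S.m) :
    MeasurePreserving (fun ω : S.Outcome => (xi ω i, iter ω 0 j r)) S.law
      ((gaussianVec S.d S.sigmaXi).prod (gaussianVec S.d S.sigma0)) :=
  ((measurePreserving_eval (fun _ : Fin S.n => gaussianVec S.d S.sigmaXi) i).prod
    (measurePreserving_weight S j r)).comp (measurePreserving_features hτ)

lemma measurableSet_lt_abs_inner {d : ℕ} (v : Vec d) (a : ℝ) :
    MeasurableSet {z : Vec d | a < |(inner ℝ v z : ℝ)|} := by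
  have h : Measurable fun z : Vec d => |(inner ℝ v z : ℝ)| := by fun_prop
  exact measurableSet_lt measurable_const h

lemma measurableSet_pair {d : ℕ} (K a : ℝ) :
    MeasurableSet {p : Vec d × Vec d | ‖p.1‖ ^ 2 ≤ K ∧ a < |(inner ℝ p.1 p.2 : ℝ)|} := by
  have h₁ : Measurable fun p : Vec d × Vec d => ‖p.1‖ ^ 2 := by fun_prop
  have h₂ : Measurable fun p : Vec d × Vec d => |(inner ℝ p.1 p.2 : ℝ)| := by fun_prop
  exact (measurableSet_le h₁ measurable_const).inter (measurableSet_lt measurable_const h₂)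

lemma law_norm_xi_le (hS : S.Basic) (hτ : ∀ b, S.tau b ∈ Set.Icc 0 1) {θ : ℝ} (h₀ : 0 ≤ θ)
    (h₁ : θ ≤ 1) :
    S.law.real {ω | ∃ i, θ * S.noiseEnergy < |‖xi ω i‖ ^ 2 - S.noiseEnergy|}
      ≤ S.n * (2 * Real.exp (-(θ ^ 2 / 8 * S.d))) := by
  refine measureReal_exists_le _ (by simp) fun i => ?_
  refine le_trans (le_of_eq ?_) (gaussianVec_norm_sq_dev_le S.d hS.sigmaXi_pos h₀ h₁)
  have h : Measurable fun z : Vec S.d => |‖z‖ ^ 2 - S.sigmaXi ^ 2 * S.d| := by fun_prop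
  exact (measurePreserving_xi hτ i).measureReal_preimage
    (measurableSet_lt measurable_const h).nullMeasurableSet

lemma law_inner_xi_le (hτ : ∀ b, S.tau b ∈ Set.Icc 0 1) {a K L : ℝ} (ha : 0 ≤ a)
    (hL : S.sigmaXi ^ 2 * K ≤ L) :
    S.law.real {ω | ∃ p : Fin S.n × Fin S.n, p.1 ≠ p.2 ∧ ‖xi ω p.1‖ ^ 2 ≤ K ∧
        a < |(inner ℝ (xi ω p.1) (xi ω p.2) : ℝ)|}
      ≤ S.n * S.n * (2 * Real.exp (-(a ^ 2 / (2 * L)))) := by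
  refine measureReal_exists_le _ (by simp) fun p => ?_
  by_cases hp : p.1 = p.2
  · simp only [hp, ne_eq, not_true_eq_false, false_and, Set.ofPred_false, measureReal_empty]
    positivity
  · simp only [hp, ne_eq, not_false_eq_true, true_and]
    refine le_trans (le_of_eq ?_) (gaussianVec_prod_abs_inner_gt_le (d := S.d) S.sigmaXi S.sigmaXi ha hL)
    exact (measurePreserving_xi_pair hτ hp).measureReal_preimage
      (measurableSet_pair K a).nullMeasurableSet

lemma law_inner_mu_le (hτ : ∀ b, S.tau b ∈ Set.Icc 0 1) {a L : ℝ} (ha : 0 ≤ a)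
    (hL : S.sigmaXi ^ 2 * ‖S.mu‖ ^ 2 ≤ L) :
    S.law.real {ω | ∃ i, a < |(inner ℝ S.mu (xi ω i) : ℝ)|}
      ≤ S.n * (2 * Real.exp (-(a ^ 2 / (2 * L)))) := by
  refine measureReal_exists_le _ (by simp) fun i => ?_
  refine le_trans (le_of_eq ?_) (gaussianVec_abs_inner_gt_le S.sigmaXi S.mu ha hL)
  exact (measurePreserving_xi hτ i).measureReal_preimage
    (measurableSet_lt_abs_inner _ _).nullMeasurableSet

lemma law_init_mu_le (hτ : ∀ b, S.tau b ∈ Set.Icc 0 1) {a L : ℝ} (ha : 0 ≤ a)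
    (hL : S.sigma0 ^ 2 * ‖S.mu‖ ^ 2 ≤ L) :
    S.law.real {ω | ∃ p : Bool × Fin S.m, a < |(inner ℝ S.mu (iter ω 0 p.1 p.2) : ℝ)|}
      ≤ 2 * S.m * (2 * Real.exp (-(a ^ 2 / (2 * L)))) := by
  refine measureReal_exists_le _ (by simp) fun p => ?_
  refine le_trans (le_of_eq ?_) (gaussianVec_abs_inner_gt_le S.sigma0 S.mu ha hL)
  exact (measurePreserving_init hτ p.1 p.2).measureReal_preimage
    (measurableSet_lt_abs_inner _ _).nullMeasurableSet

lemma law_init_xi_le (hτ : ∀ b, S.tau b ∈ Set.Icc 0 1) {a K L : ℝ} (ha : 0 ≤ a)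
    (hL : S.sigma0 ^ 2 * K ≤ L) :
    S.law.real {ω | ∃ p : Fin S.n × Bool × Fin S.m, ‖xi ω p.1‖ ^ 2 ≤ K ∧
        a < |(inner ℝ (xi ω p.1) (iter ω 0 p.2.1 p.2.2) : ℝ)|}
      ≤ S.n * (2 * S.m) * (2 * Real.exp (-(a ^ 2 / (2 * L)))) := by
  refine measureReal_exists_le _ (by simp) fun p => ?_
  refine le_trans (le_of_eq ?_) (gaussianVec_prod_abs_inner_gt_le (d := S.d) S.sigmaXi S.sigma0 ha hL)
  exact (measurePreserving_xi_init hτ p.1 p.2.1 p.2.2).measureReal_preimage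
    (measurableSet_pair K a).nullMeasurableSet

lemma law_init_norm_le (hS : S.Basic) (hτ : ∀ b, S.tau b ∈ Set.Icc 0 1) :
    S.law.real {ω | ∃ p : Bool × Fin S.m, 2 * (S.sigma0 ^ 2 * S.d) < ‖iter ω 0 p.1 p.2‖ ^ 2}
      ≤ 2 * S.m * Real.exp (-(1 / 8 * S.d)) := by
  refine measureReal_exists_le _ (by simp) fun p => ?_
  have h := gaussianVec_norm_sq_gt_le S.d hS.sigma0_pos (θ := 1) (by norm_num) le_rfl
  norm_num at h ⊢
  refine le_trans (le_of_eq ?_) h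
  have h' : Measurable fun z : Vec S.d => ‖z‖ ^ 2 := by fun_prop
  exact (measurePreserving_init hτ p.1 p.2).measureReal_preimage
    (measurableSet_lt measurable_const h').nullMeasurableSet

lemma law_noisy_card_le (hS : S.Basic) (hτ : ∀ b, S.tau b ∈ Set.Icc 0 1)
    {t₂ θ : ℝ} (hτ₂ : ∀ b, S.tau b ≤ t₂) (hθ : 0 ≤ θ) :
    S.law.real {ω | ∃ b, (t₂ + θ) * (S.n / 2)
        < ((Finset.univ.filter fun i => S.y i = b ∧ obs ω i ≠ S.y i).card : ℝ)}
      ≤ 2 * Real.exp (-(θ ^ 2 * S.n)) := by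
  refine measureReal_exists_le _ (by simp) fun b => ?_
  refine le_trans (le_of_eq ?_) (hS.noisy_card_gt_le hτ hτ₂ hθ b)
  exact (measurePreserving_labels hτ).measureReal_preimage
    (s := {l | (t₂ + θ) * (S.n / 2)
      < ((Finset.univ.filter fun i => S.y i = b ∧ l i ≠ S.y i).card : ℝ)})
    (Set.toFinite _).measurableSet.nullMeasurableSet

/-- If the network classifies correctly whenever the fresh noise is not too aligned with any
neuron, then the test error is at most the probability of such an alignment. -/
lemma Basic.testError_le (hS : S.Basic) (t : ℕ) {s K : ℝ} (hs : 0 ≤ s)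
    (hW : ∀ j r, S.sigmaXi ^ 2 * ‖iter ω t j r‖ ^ 2 ≤ K)
    (h : ∀ (b : Bool) (i : Fin S.n) (ζ : Vec S.d),
      (∀ j r, (inner ℝ (iter ω t j r) ζ : ℝ) ≤ s) →
        0 ≤ sgn b * network (iter ω t) (sgn b • S.mu, xi ω i + ζ)) :
    testError ω t ≤ 2 * S.m * Real.exp (-(s ^ 2 / (2 * K))) := by
  have : Nonempty (Fin S.n) := ⟨⟨0, hS.n_pos⟩⟩
  have hm : Measurable fun p : Bool × Fin S.n × Vec S.d =>
      (((sgn p.1 • S.mu, xi ω p.2.1 + p.2.2), p.1) : (Vec S.d × Vec S.d) × Bool) := by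
    have h1 : Measurable (xi ω) := measurable_of_countable _
    have h2 := measurable_sgn
    fun_prop
  have hm' : MeasurableSet {p : (Vec S.d × Vec S.d) × Bool |
      sgn p.2 * network (iter ω t) p.1 < 0} := by
    have h1 := measurable_network (iter ω t)
    have h2 := measurable_sgn
    have h3 : Measurable fun p : (Vec S.d × Vec S.d) × Bool =>
        sgn p.2 * network (iter ω t) p.1 := by fun_prop
    exact measurableSet_lt h3 measurable_const
  have hA : MeasurableSet {ζ : Vec S.d | ∃ p : Bool × Fin S.m,
      s < inner ℝ (iter ω t p.1 p.2) ζ} := by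
    rw [Set.ofPred_exists]
    refine MeasurableSet.iUnion fun p => ?_
    have h1 : Measurable fun ζ : Vec S.d => (inner ℝ (iter ω t p.1 p.2) ζ : ℝ) := by fun_prop
    exact measurableSet_lt measurable_const h1
  rw [testError, testLaw, map_measureReal_apply hm hm']
  calc _ ≤ ((uniformOn (Set.univ : Set Bool)).prod
        ((uniformOn (Set.univ : Set (Fin S.n))).prod (gaussianVec S.d S.sigmaXi))).real
          ((fun p => p.2.2) ⁻¹' {ζ : Vec S.d | ∃ p : Bool × Fin S.m,
            s < inner ℝ (iter ω t p.1 p.2) ζ}) := by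
        refine measureReal_mono fun p hp => ?_
        simp only [Set.mem_preimage, Set.mem_ofPred_eq] at hp ⊢
        by_contra hcon
        push Not at hcon
        exact absurd (h p.1 p.2.1 p.2.2 fun j r => hcon (j, r)) (not_le.2 hp)
    _ = (gaussianVec S.d S.sigmaXi).real {ζ : Vec S.d | ∃ p : Bool × Fin S.m,
            s < inner ℝ (iter ω t p.1 p.2) ζ} :=
        (measurePreserving_snd.comp measurePreserving_snd).measureReal_preimage
          hA.nullMeasurableSet
    _ ≤ _ := measureReal_exists_le _ (by simp) fun p =>
        gaussianVec_inner_gt_le S.sigmaXi _ hs (hW p.1 p.2)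

end Setup

/-! ### The union bound for the concentration event -/

/-- The exponential is at most `(δ/N)⁸`; two powers of `N` pay for the number of events and the
other six, with `N ≥ 2`, pay for the constants. -/
lemma mul_exp_neg_le_of_log_le {δ N q x : ℝ} (hδ : 0 < δ) (hδ₁ : δ < 1) (hN : 2 ≤ N)
    (hq : q ≤ 4 * N ^ 2) (hx : 8 * Real.log (N / δ) ≤ x) : q * Real.exp (-x) ≤ δ / 8 := by
  have hN0 : 0 < N := by linarith
  have h1 : Real.exp (-x) ≤ (δ / N) ^ 8 := by
    have h : Real.exp (8 * Real.log (δ / N)) = (δ / N) ^ 8 := by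
      rw [show (8 : ℝ) = ((8 : ℕ) : ℝ) by norm_num, Real.exp_nat_mul,
        Real.exp_log (by positivity)]
    rw [← h, Real.exp_le_exp, ← inv_div N δ, Real.log_inv]
    linarith
  have h2 : δ ^ 8 ≤ δ := pow_le_of_le_one hδ.le hδ₁.le (by norm_num)
  have h3 : (2 : ℝ) ^ 6 ≤ N ^ 6 := by gcongr
  calc q * Real.exp (-x) ≤ 4 * N ^ 2 * (δ / N) ^ 8 := by gcongr
    _ = 4 * δ ^ 8 / N ^ 6 := by field_simp
    _ ≤ 4 * δ / 2 ^ 6 := by gcongr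
    _ ≤ δ / 8 := by linarith

lemma mul_two_mul_exp_neg_le_of_log_le {δ N q x : ℝ} (hδ : 0 < δ) (hδ₁ : δ < 1) (hN : 2 ≤ N)
    (hq : q ≤ 2 * N ^ 2) (hx : 8 * Real.log (N / δ) ≤ x) :
    q * (2 * Real.exp (-x)) ≤ δ / 8 := by
  rw [← mul_assoc]
  exact mul_exp_neg_le_of_log_le hδ hδ₁ hN (by linarith) hx

namespace Setup

variable {S : Setup}

/-- The truncations `‖ξ_i‖² ≤ 2D` in the second and fifth events cost nothing, because they hold
outside the first event. -/
lemma not_trainingEvent_subset {t₂ θ : ℝ} (hD : 0 < S.noiseEnergy) (hθ : θ ≤ 1) :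
    {ω : S.Outcome | ¬ TrainingEvent t₂ θ ω} ⊆
      {ω | ∃ i, θ * S.noiseEnergy < |‖xi ω i‖ ^ 2 - S.noiseEnergy|} ∪
      ({ω | ∃ p : Fin S.n × Fin S.n, p.1 ≠ p.2 ∧ ‖xi ω p.1‖ ^ 2 ≤ 2 * S.noiseEnergy ∧
        θ * (S.noiseEnergy / S.n) < |(inner ℝ (xi ω p.1) (xi ω p.2) : ℝ)|} ∪
      ({ω | ∃ i, θ * (S.noiseEnergy / S.n) < |(inner ℝ S.mu (xi ω i) : ℝ)|} ∪
      ({ω | ∃ p : Bool × Fin S.m, θ < |(inner ℝ S.mu (iter ω 0 p.1 p.2) : ℝ)|} ∪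
      ({ω | ∃ p : Fin S.n × Bool × Fin S.m, ‖xi ω p.1‖ ^ 2 ≤ 2 * S.noiseEnergy ∧
        θ < |(inner ℝ (xi ω p.1) (iter ω 0 p.2.1 p.2.2) : ℝ)|} ∪
      ({ω | ∃ p : Bool × Fin S.m, 2 * (S.sigma0 ^ 2 * S.d) < ‖iter ω 0 p.1 p.2‖ ^ 2} ∪
      {ω | ∃ b, (t₂ + θ) * (S.n / 2)
        < ((Finset.univ.filter fun i => S.y i = b ∧ obs ω i ≠ S.y i).card : ℝ)}))))) := by
  intro ω hω
  by_contra hcon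
  simp only [Set.mem_union, Set.mem_ofPred_eq, not_or, not_exists, not_and, not_lt] at hcon
  obtain ⟨h1, h2, h3, h4, h5, h6, h7⟩ := hcon
  have hx : ∀ i, ‖xi ω i‖ ^ 2 ≤ 2 * S.noiseEnergy := fun i => by
    have := (abs_le.1 (h1 i)).2
    nlinarith
  exact hω ⟨h1, fun i k hik => h2 (i, k) hik (hx i), h3, fun j r => h4 (j, r),
    fun i j r => h5 (i, j, r) (hx i), fun j r => h6 (j, r), h7⟩

/-- Each of the seven events receives a share `δ/8`. The logarithm in each hypothesis is the one
that the corresponding size assumption controls. -/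
lemma Basic.law_not_trainingEvent_le (hS : S.Basic) (hτ : ∀ b, S.tau b ∈ Set.Icc 0 1)
    {t₂ θ δ : ℝ} (hτ₂ : ∀ b, S.tau b ≤ t₂) (hθ₀ : 0 ≤ θ) (hθ₁ : θ ≤ 1) (hδ : 0 < δ)
    (hδ₁ : δ < 1) (hn : (2 : ℝ) ≤ S.n) (hm : (2 : ℝ) ≤ S.m)
    (h_norm : 8 * Real.log (S.n * S.m / δ) ≤ θ ^ 2 / 8 * S.d)
    (h_xi : 8 * Real.log (S.n * S.m / δ) ≤
      (θ * (S.noiseEnergy / S.n)) ^ 2 / (2 * (S.sigmaXi ^ 2 * (2 * S.noiseEnergy))))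
    (h_mu : 8 * Real.log (S.n / δ) ≤
      (θ * (S.noiseEnergy / S.n)) ^ 2 / (2 * (S.sigmaXi ^ 2 * ‖S.mu‖ ^ 2)))
    (h_init_mu : 8 * Real.log (S.m / δ) ≤ θ ^ 2 / (2 * (S.sigma0 ^ 2 * ‖S.mu‖ ^ 2)))
    (h_init_xi : 8 * Real.log (S.n * S.m / δ) ≤
      θ ^ 2 / (2 * (S.sigma0 ^ 2 * (2 * S.noiseEnergy))))
    (h_card : 8 * Real.log (S.m / δ) ≤ θ ^ 2 * S.n) :
    S.law.real {ω | ¬ TrainingEvent t₂ θ ω} ≤ δ := by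
  have := isProbabilityMeasure_law hτ
  have hD := hS.noiseEnergy_pos
  have hnm : (2 : ℝ) ≤ S.n * S.m := by nlinarith
  have hn_le : (S.n : ℝ) ≤ S.n * S.m := by nlinarith
  have hm_le : (S.m : ℝ) ≤ S.n * S.m := by nlinarith
  have hn_sq : (S.n : ℝ) ≤ S.n ^ 2 := by nlinarith
  have hm_sq : (S.m : ℝ) ≤ S.m ^ 2 := by nlinarith
  have hnm_sq : (S.n * S.m : ℝ) ≤ (S.n * S.m) ^ 2 := by nlinarith
  have hnn : (S.n * S.n : ℝ) ≤ (S.n * S.m) ^ 2 := by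
    rw [← pow_two]
    gcongr
  have ha : 0 ≤ θ * (S.noiseEnergy / S.n) := by positivity
  have b1 := (law_norm_xi_le hS hτ hθ₀ hθ₁).trans
    (mul_two_mul_exp_neg_le_of_log_le hδ hδ₁ hnm (by linarith) h_norm)
  have b2 := (law_inner_xi_le hτ ha le_rfl).trans
    (mul_two_mul_exp_neg_le_of_log_le hδ hδ₁ hnm (by linarith) h_xi)
  have b3 := (law_inner_mu_le hτ ha le_rfl).trans
    (mul_two_mul_exp_neg_le_of_log_le hδ hδ₁ hn (by linarith) h_mu)
  have b4 := (law_init_mu_le hτ hθ₀ le_rfl).trans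
    (mul_two_mul_exp_neg_le_of_log_le hδ hδ₁ hm (by linarith) h_init_mu)
  have b5 := (law_init_xi_le hτ hθ₀ le_rfl).trans
    (mul_two_mul_exp_neg_le_of_log_le hδ hδ₁ hnm (by linarith) h_init_xi)
  have h_norm' : 8 * Real.log (S.n * S.m / δ) ≤ 1 / 8 * S.d := by
    refine h_norm.trans ?_
    gcongr
    nlinarith
  have b6 := (law_init_norm_le hS hτ).trans
    (mul_exp_neg_le_of_log_le hδ hδ₁ hnm (by linarith) h_norm')
  -- Only two classes are counted, but `N = m` is taken because `n` is assumed large relative to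
  -- `log(m/δ)`.
  have b7 := (law_noisy_card_le hS hτ hτ₂ hθ₀).trans
    (mul_exp_neg_le_of_log_le hδ hδ₁ hm (by linarith) h_card)
  have union_le : ∀ {A B : Set S.Outcome} {x y : ℝ}, S.law.real A ≤ x → S.law.real B ≤ y →
      S.law.real (A ∪ B) ≤ x + y := fun hA hB =>
    (measureReal_union_le _ _).trans (add_le_add hA hB)
  refine (measureReal_mono (not_trainingEvent_subset hD hθ₁)).trans
    ((union_le b1 (union_le b2 (union_le b3 (union_le b4 (union_le b5 (union_le b6 b7)))))).trans
      ?_)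
  linarith

/-! ### Choice of the constants -/

/-- The constants of the first stage: any gap `g > 0` between the learning rates leaves room for a
short stage and a good accuracy. -/
lemma exists_stage_constants {c₁ c₂ t₂ : ℝ} (hc : c₁ ≤ c₂) (ht₂ : 0 ≤ t₂)
    (h : 2 < c₁ * (1 - 2 * t₂)) (h' : t₂ < 1 / 2) :
    ∃ c θ lam g : ℝ, 2 ≤ c₁ ∧ 0 < θ ∧ θ ≤ 1 / 16 ∧ 0 < c ∧ c ≤ 1 / 2 ∧
      lam = 2 * c * (c₂ + 2) + 2 * (θ * (c₂ + 5)) ∧ lam ≤ 1 / 4 ∧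
      g = c₁ * (1 - 2 * t₂) / 4 - 1 / 2 ∧ 0 < g ∧ (c₁ / 2 + 1) * (θ + lam) ≤ g / 2 ∧
      24 * (θ * (c₂ + 5)) ≤ c * g := by
  have hc₁ : 2 ≤ c₁ := by
    by_contra hlt
    push Not at hlt
    nlinarith
  set g := c₁ * (1 - 2 * t₂) / 4 - 1 / 2 with hg
  have hg₀ : 0 < g := by linarith
  have hg₁ : g ≤ c₂ / 4 := by nlinarith
  -- Below, `θ + lam ≤ c(3c₂ + 5)` and `c₁/2 + 1 ≤ (c₂ + 2)/2`, so this `c` makes their product at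
  -- most `g/2`.
  set c := g / ((c₂ + 2) * (3 * c₂ + 5)) with hc_def
  have hc₀ : 0 < c := div_pos hg₀ (by nlinarith)
  have hcg : c * ((c₂ + 2) * (3 * c₂ + 5)) = g := div_mul_cancel₀ _ (by nlinarith)
  have hc_le : c ≤ 1 / 20 := by
    rw [hc_def, div_le_iff₀ (by nlinarith)]
    nlinarith
  set θ := c * g / (24 * (c₂ + 5)) with hθ
  have hθ₀ : 0 < θ := div_pos (mul_pos hc₀ hg₀) (by linarith)
  have hθg : 24 * (θ * (c₂ + 5)) = c * g := by
    rw [hθ]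
    have : c₂ + 5 ≠ 0 := by linarith
    field_simp
  have hθ_le : θ ≤ c / 96 := by
    rw [hθ, div_le_iff₀ (by linarith)]
    nlinarith
  have hsum : θ + (2 * c * (c₂ + 2) + 2 * (θ * (c₂ + 5))) ≤ c * (3 * c₂ + 5) := by
    have : 2 * (θ * (c₂ + 5)) = c * g / 12 := by linarith
    rw [this]
    nlinarith [mul_le_mul_of_nonneg_left hg₁ hc₀.le]
  refine ⟨c, θ, _, g, hc₁, hθ₀, by linarith, hc₀, by linarith, rfl, ?_, rfl, hg₀, ?_, hθg.le⟩
  · have h1 : c * (3 * c₂ + 5) ≤ 1 / 4 := by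
      have h2 : (c * (3 * c₂ + 5)) * (c₂ + 2) ≤ 1 / 4 * (c₂ + 2) := by linarith
      exact le_of_mul_le_mul_right h2 (by linarith)
    linarith
  · calc _ ≤ ((c₂ + 2) / 2) * (c * (3 * c₂ + 5)) :=
          mul_le_mul (by linarith) hsum (by
            have : 0 < c₂ := by linarith
            positivity) (by linarith)
      _ = g / 2 := by linarith

/-- A power of the logarithm is `o(Y)`. Applied to `Y = X/ε`, this gives `T* ≥ e`, so that the
factor `log(T*)²` in the assumption on `d` is at least 1. -/
lemma exists_forall_exp_one_le (κ : ℝ) (hκ : 0 < κ) (p : ℕ) :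
    ∃ Y₀ : ℝ, 0 < Y₀ ∧ ∀ Y, Y₀ ≤ Y → Real.exp 1 ≤ κ⁻¹ * Y / Real.log Y ^ p := by
  have h := (Real.isLittleO_pow_log_id_atTop (n := p)).bound
    (show 0 < κ⁻¹ / Real.exp 1 by positivity)
  obtain ⟨Y₀, hY₀⟩ := Filter.eventually_atTop.1 h
  refine ⟨max Y₀ 2, by positivity, fun Y hY => ?_⟩
  have hY2 : 2 ≤ Y := (le_max_right _ _).trans hY
  have hlog : 0 < Real.log Y ^ p := pow_pos (Real.log_pos (by linarith)) p
  have h1 := hY₀ Y ((le_max_left _ _).trans hY)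
  rw [Real.norm_of_nonneg hlog.le, id, Real.norm_of_nonneg (by linarith)] at h1
  rw [le_div_iff₀ hlog]
  calc _ ≤ Real.exp 1 * (κ⁻¹ / Real.exp 1 * Y) := by gcongr
    _ = _ := by field_simp

end Setup

/-! ### Consequences of the main condition -/

namespace Setup

variable {S : Setup} {c₁ c₂ t₁ t₂ C δ T : ℝ}

lemma Basic.two_le_n (hS : S.Basic) : (2 : ℝ) ≤ S.n := by
  have h1 := hS.card_class true
  have hn : (0 : ℝ) < S.n := by exact_mod_cast hS.n_pos
  have h2 : (0 : ℝ) < (Finset.univ.filter fun i => S.y i = true).card := by rw [h1]; linarith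
  have h3 : (1 : ℝ) ≤ (Finset.univ.filter fun i => S.y i = true).card := by
    exact_mod_cast Nat.cast_pos.1 h2
  linarith

/-- Since `log 2 > 1/2`, the logarithms in the main condition are bounded away from zero. -/
lemma half_le_log_div {N δ : ℝ} (hN : 2 ≤ N) (hδ : 0 < δ) (hδ₁ : δ < 1) : 1 / 2 ≤ Real.log (N / δ) := by
  have h : (2 : ℝ) ≤ N / δ := by
    rw [le_div_iff₀ hδ]
    nlinarith
  have := Real.log_le_log (by norm_num) h
  linarith [Real.log_two_gt_d9]

lemma MainCondition.two_le_m (hM : S.MainCondition c₁ c₂ t₁ t₂ C δ T) (hS : S.Basic)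
    (hC : 4 ≤ C) (hδ : 0 < δ) (hδ₁ : δ < 1) : (2 : ℝ) ≤ S.m := by
  have h := half_le_log_div hS.two_le_n hδ hδ₁
  have := hM.m_ge
  nlinarith

lemma n_mul_snr_sq (S : Setup) : S.n * S.snr ^ 2 = S.n * ‖S.mu‖ ^ 2 / S.noiseEnergy := by
  rw [snr, div_pow, mul_pow, Real.sq_sqrt (by positivity), noiseEnergy, mul_div_assoc]

lemma MainCondition.signal_ge (hM : S.MainCondition c₁ c₂ t₁ t₂ C δ T) (hS : S.Basic) :
    c₁ * S.noiseEnergy ≤ S.n * ‖S.mu‖ ^ 2 := by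
  have h := hM.snr_mem.1
  rwa [n_mul_snr_sq, le_div_iff₀ hS.noiseEnergy_pos] at h

lemma MainCondition.signal_le (hM : S.MainCondition c₁ c₂ t₁ t₂ C δ T) (hS : S.Basic) :
    S.n * ‖S.mu‖ ^ 2 ≤ c₂ * S.noiseEnergy := by
  have h := hM.snr_mem.2
  rwa [n_mul_snr_sq, div_le_iff₀ hS.noiseEnergy_pos] at h

/-- The learning rate bound `η ≤ C⁻¹n/D` makes one step short compared with the stage, so that
rounding `cX` to an integer is harmless. -/
lemma MainCondition.timeScale_ge (hM : S.MainCondition c₁ c₂ t₁ t₂ C δ T) (hS : S.Basic)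
    (hC : 0 < C) : C ≤ S.timeScale := by
  have hσ := hS.sigmaXi_pos
  have hη := hS.eta_pos
  have hd : (0 : ℝ) < S.d := by exact_mod_cast hS.d_pos
  have hn : (0 : ℝ) < S.n := by exact_mod_cast hS.n_pos
  have hm : (1 : ℝ) ≤ S.m := by exact_mod_cast hS.m_pos
  have h1 : S.eta ≤ C⁻¹ * ((S.sigmaXi ^ 2)⁻¹ * (S.d : ℝ)⁻¹ * S.n) :=
    hM.eta_le.trans (mul_le_mul_of_nonneg_left (min_le_right _ _) (by positivity))
  have h2 : C * S.eta * (S.sigmaXi ^ 2 * S.d) ≤ S.n := by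
    calc _ ≤ C * (C⁻¹ * ((S.sigmaXi ^ 2)⁻¹ * (S.d : ℝ)⁻¹ * S.n)) * (S.sigmaXi ^ 2 * S.d) := by
          gcongr
      _ = S.n := by field_simp
  have h3 : S.timeScale = S.n * S.m / (S.eta * (S.sigmaXi ^ 2 * S.d)) := by
    unfold timeScale
    field_simp
  rw [h3, le_div_iff₀ (by positivity)]
  nlinarith

lemma MainCondition.dim_ge (hM : S.MainCondition c₁ c₂ t₁ t₂ C δ T) (hS : S.Basic)
    (hC : 4 ≤ C) (hδ : 0 < δ) (hδ₁ : δ < 1) (hT : 1 ≤ Real.log T) :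
    C * ((S.n : ℝ) ^ 2 * Real.log (S.n * S.m / δ)) ≤ S.d := by
  have hn := hS.two_le_n
  have hm := hM.two_le_m hS hC hδ hδ₁
  have hL := half_le_log_div (N := S.n * S.m) (by nlinarith) hδ hδ₁
  refine le_trans ?_ hM.d_ge
  refine mul_le_mul_of_nonneg_left (le_trans ?_ (le_max_left _ _)) (by linarith)
  exact le_mul_of_one_le_right (by positivity) (one_le_pow₀ hT)

lemma MainCondition.sigma0_sq_noiseEnergy_le (hM : S.MainCondition c₁ c₂ t₁ t₂ C δ T)
    (hS : S.Basic) (hC : 0 < C) :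
    S.sigma0 ^ 2 * S.noiseEnergy ≤ C⁻¹ ^ 2 * (S.n / S.d) := by
  have hσ := hS.sigmaXi_pos
  have hσ₀ := hS.sigma0_pos
  have hd : (0 : ℝ) < S.d := by exact_mod_cast hS.d_pos
  have h1 : S.sigma0 ≤ C⁻¹ * (Real.sqrt S.n * S.sigmaXi⁻¹ * (S.d : ℝ)⁻¹) :=
    hM.sigma0_le.trans (mul_le_mul_of_nonneg_left (min_le_left _ _) (by positivity))
  calc _ ≤ (C⁻¹ * (Real.sqrt S.n * S.sigmaXi⁻¹ * (S.d : ℝ)⁻¹)) ^ 2 * S.noiseEnergy := by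
        have := hS.noiseEnergy_pos
        gcongr
    _ = C⁻¹ ^ 2 * (Real.sqrt S.n ^ 2 / S.d) := by
        unfold noiseEnergy
        field_simp
    _ = _ := by rw [Real.sq_sqrt (by positivity)]

lemma MainCondition.sigma0_sq_mu_le (hM : S.MainCondition c₁ c₂ t₁ t₂ C δ T)
    (hS : S.Basic) (hC : 4 ≤ C) (hδ : 0 < δ) (hδ₁ : δ < 1) (hμ : 0 < ‖S.mu‖) :
    S.sigma0 ^ 2 * ‖S.mu‖ ^ 2 ≤ C⁻¹ ^ 2 * (Real.log (S.m / δ))⁻¹ := by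
  have hσ₀ := hS.sigma0_pos
  have hL := half_le_log_div (hM.two_le_m hS hC hδ hδ₁) hδ hδ₁
  have h1 : S.sigma0 ≤ C⁻¹ * (‖S.mu‖⁻¹ * (Real.sqrt (Real.log (S.m / δ)))⁻¹) :=
    hM.sigma0_le.trans (mul_le_mul_of_nonneg_left (min_le_right _ _) (by positivity))
  calc _ ≤ (C⁻¹ * (‖S.mu‖⁻¹ * (Real.sqrt (Real.log (S.m / δ)))⁻¹)) ^ 2 * ‖S.mu‖ ^ 2 := by gcongr
    _ = C⁻¹ ^ 2 * (Real.sqrt (Real.log (S.m / δ)) ^ 2)⁻¹ := by field_simp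
    _ = _ := by rw [Real.sq_sqrt (by linarith)]

lemma tau_mem (hM : S.MainCondition c₁ c₂ t₁ t₂ C δ T) (b : Bool) : S.tau b ∈ Set.Icc t₁ t₂ := by
  cases b
  · exact hM.tauNeg_mem
  · exact hM.tauPos_mem

set_option maxHeartbeats 400000 in
/-- Under the main condition with a large constant, the concentration event is likely. -/
lemma MainCondition.law_not_trainingEvent_le (hM : S.MainCondition c₁ c₂ t₁ t₂ C δ T)
    (hS : S.Basic) (hδ : 0 < δ) (hδ₁ : δ < 1) (hT : 1 ≤ Real.log T) (ht₁ : 0 < t₁)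
    (ht₂ : t₂ < 1 / 2) (hc₁ : 2 ≤ c₁) {θ : ℝ} (hθ₀ : 0 < θ) (hθ₁ : θ ≤ 1)
    (hC : 4 ≤ C) (hCθ : 64 * (1 + c₂ ^ 2) ≤ C * θ ^ 2) :
    S.law.real {ω | ¬ TrainingEvent t₂ θ ω} ≤ δ := by
  have hσ := hS.sigmaXi_pos
  have hσ₀ := hS.sigma0_pos
  have hD := hS.noiseEnergy_pos
  have hd : (0 : ℝ) < S.d := by exact_mod_cast hS.d_pos
  have hn := hS.two_le_n
  have hm := hM.two_le_m hS hC hδ hδ₁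
  have hL := half_le_log_div (N := S.n * S.m) (by nlinarith) hδ hδ₁
  have hLm := half_le_log_div hm hδ hδ₁
  have hLn := half_le_log_div hn hδ hδ₁
  have hdim := hM.dim_ge hS hC hδ hδ₁ hT
  have hsig := hM.signal_ge hS
  have hsig' := hM.signal_le hS
  have hμ2 : 0 < ‖S.mu‖ ^ 2 := by
    have : 0 < S.n * ‖S.mu‖ ^ 2 := lt_of_lt_of_le (by positivity) hsig
    exact pos_of_mul_pos_right this (by linarith)
  have hμ : 0 < ‖S.mu‖ := lt_of_le_of_ne (norm_nonneg _) fun h => by simp [← h] at hμ2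
  have hc₂ : 0 < c₂ := by
    have : 0 < c₂ * S.noiseEnergy := lt_of_lt_of_le (by positivity) hsig'
    exact pos_of_mul_pos_left this hD.le
  have hCθ' : 64 ≤ C * θ ^ 2 := by nlinarith [sq_nonneg c₂]
  have hCC : 64 ≤ θ ^ 2 * C ^ 2 := by
    calc 64 ≤ C * θ ^ 2 := hCθ'
      _ ≤ C ^ 2 * θ ^ 2 := by
          gcongr
          exact le_self_pow₀ (by linarith) two_ne_zero
      _ = _ := mul_comm _ _
  have hL0 : 0 < Real.log (S.n * S.m / δ) := by linarith
  set L := Real.log (S.n * S.m / δ)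
  have hdn : C * L ≤ S.d / (S.n : ℝ) ^ 2 := by
    rw [le_div_iff₀ (by positivity)]
    linarith
  have hdn' : (S.d : ℝ) / (S.n : ℝ) ^ 2 ≤ S.d := div_le_self hd.le (by nlinarith)
  have hθC : 64 * L ≤ θ ^ 2 * (S.d / (S.n : ℝ) ^ 2) := by
    calc 64 * L ≤ C * θ ^ 2 * L := by gcongr
      _ = θ ^ 2 * (C * L) := by ring
      _ ≤ _ := by gcongr
  refine hS.law_not_trainingEvent_le (fun b => ?_) (fun b => (tau_mem hM b).2) hθ₀.le hθ₁ hδ hδ₁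
    hn hm ?_ ?_ ?_ ?_ ?_ ?_
  · have := tau_mem hM b
    exact ⟨by linarith [this.1], by linarith [this.2]⟩
  · have : θ ^ 2 * (S.d / (S.n : ℝ) ^ 2) ≤ θ ^ 2 * S.d := by gcongr
    linarith
  -- Near-orthogonality of the patches at accuracy `θD/n` is what uses the full factor `n²` in the
  -- assumption on `d`.
  · have : (θ * (S.noiseEnergy / S.n)) ^ 2 / (2 * (S.sigmaXi ^ 2 * (2 * S.noiseEnergy)))
        = θ ^ 2 * (S.d / (S.n : ℝ) ^ 2) / 4 := by
      unfold noiseEnergy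
      field_simp
      norm_num
    rw [this]
    linarith
  -- The upper bound on `n SNR²` turns the threshold `θD/n` into a multiple of `‖μ‖²`, and the lower
  -- bound on `‖μ‖²` then suffices.
  · have h1 : ‖S.mu‖ ^ 2 / c₂ ≤ S.noiseEnergy / S.n := by
      rw [div_le_div_iff₀ hc₂ (by linarith)]
      linarith
    have h2 := hM.mu_ge
    rw [le_div_iff₀ (by positivity)]
    calc 8 * Real.log (S.n / δ) * (2 * (S.sigmaXi ^ 2 * ‖S.mu‖ ^ 2))
        = 16 * S.sigmaXi ^ 2 * Real.log (S.n / δ) * ‖S.mu‖ ^ 2 := by ring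
      _ ≤ (C * θ ^ 2 / c₂ ^ 2) * S.sigmaXi ^ 2 * Real.log (S.n / δ) * ‖S.mu‖ ^ 2 := by
          gcongr
          rw [le_div_iff₀ (by positivity)]
          nlinarith
      _ = θ ^ 2 / c₂ ^ 2 * ‖S.mu‖ ^ 2 * (C * S.sigmaXi ^ 2 * Real.log (S.n / δ)) := by ring
      _ ≤ θ ^ 2 / c₂ ^ 2 * ‖S.mu‖ ^ 2 * ‖S.mu‖ ^ 2 := by gcongr
      _ = (θ * (‖S.mu‖ ^ 2 / c₂)) ^ 2 := by ring
      _ ≤ _ := by gcongr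
  · have h1 := hM.sigma0_sq_mu_le hS hC hδ hδ₁ hμ
    rw [le_div_iff₀ (by positivity)]
    calc 8 * Real.log (S.m / δ) * (2 * (S.sigma0 ^ 2 * ‖S.mu‖ ^ 2))
        ≤ 8 * Real.log (S.m / δ) * (2 * (C⁻¹ ^ 2 * (Real.log (S.m / δ))⁻¹)) := by gcongr
      _ = 16 / C ^ 2 := by field_simp; norm_num
      _ ≤ _ := by
          rw [div_le_iff₀ (by positivity)]
          linarith
  · have h1 := hM.sigma0_sq_noiseEnergy_le hS (by linarith)
    rw [le_div_iff₀ (by positivity)]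
    have h2 : L * (S.n / S.d) ≤ 1 := by
      rw [mul_div_assoc', div_le_one hd]
      calc L * S.n ≤ L * (S.n : ℝ) ^ 2 := by
            gcongr
            exact le_self_pow₀ (by linarith) two_ne_zero
        _ ≤ C * (L * (S.n : ℝ) ^ 2) := le_mul_of_one_le_left (by positivity) (by linarith)
        _ = C * ((S.n : ℝ) ^ 2 * L) := by ring
        _ ≤ _ := hdim
    calc 8 * L * (2 * (S.sigma0 ^ 2 * (2 * S.noiseEnergy)))
        = 32 * L * (S.sigma0 ^ 2 * S.noiseEnergy) := by ring
      _ ≤ 32 * L * (C⁻¹ ^ 2 * (S.n / S.d)) := by gcongr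
      _ = 32 / C ^ 2 * (L * (S.n / S.d)) := by field_simp
      _ ≤ 32 / C ^ 2 * 1 := by gcongr
      _ ≤ _ := by
          rw [mul_one, div_le_iff₀ (by positivity)]
          linarith
  · have h1 := hM.n_ge
    calc 8 * Real.log (S.m / δ) ≤ C * θ ^ 2 * Real.log (S.m / δ) := by gcongr; linarith
      _ = θ ^ 2 * (C * Real.log (S.m / δ)) := by ring
      _ ≤ _ := by gcongr

/-- The union bound over the neurons is absorbed into the exponent. -/
lemma MainCondition.two_mul_m_exp_le (hM : S.MainCondition c₁ c₂ t₁ t₂ C δ T) (hS : S.Basic)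
    (hδ : 0 < δ) (hδ₁ : δ < 1) (hT : 1 ≤ Real.log T) (hC : 4 ≤ C) {s K : ℝ} (hs : 0 < s)
    (hK : 0 < K) (hCK : 4 * K / s ^ 2 ≤ C) :
    2 * S.m * Real.exp (-(s ^ 2 / (2 * (K * (S.n / S.d)))))
      ≤ Real.exp (-((S.d : ℝ) * (S.n : ℝ)⁻¹ / (4 * K / s ^ 2))) := by
  have hd : (0 : ℝ) < S.d := by exact_mod_cast hS.d_pos
  have hn := hS.two_le_n
  have hm := hM.two_le_m hS hC hδ hδ₁
  have hL := half_le_log_div (N := S.n * S.m) (by nlinarith) hδ hδ₁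
  have hdim := hM.dim_ge hS hC hδ hδ₁ hT
  have h1 : (2 * S.m : ℝ) ≤ S.n * S.m / δ := by
    rw [le_div_iff₀ hδ]
    nlinarith
  -- The Gaussian exponent is twice the right-hand side; one half pays for the `2m` neurons and the
  -- other is the final rate.
  have h2 : Real.log (2 * S.m) ≤ (S.d : ℝ) * (S.n : ℝ)⁻¹ / (4 * K / s ^ 2) := by
    refine (Real.log_le_log (by linarith) h1).trans ?_
    rw [le_div_iff₀ (by positivity), ← div_eq_mul_inv, le_div_iff₀ (by linarith)]
    have hLn := mul_nonneg (show 0 ≤ Real.log (S.n * S.m / δ) by linarith)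
      (show (0 : ℝ) ≤ S.n by linarith)
    calc Real.log (S.n * S.m / δ) * (4 * K / s ^ 2) * S.n
        = (4 * K / s ^ 2) * (Real.log (S.n * S.m / δ) * S.n) := by ring
      _ ≤ C * (Real.log (S.n * S.m / δ) * S.n) := by gcongr
      _ ≤ C * ((S.n : ℝ) ^ 2 * Real.log (S.n * S.m / δ)) := by
          refine mul_le_mul_of_nonneg_left ?_ (by linarith)
          nlinarith [mul_nonneg hLn (show (0 : ℝ) ≤ S.n - 1 by linarith)]
      _ ≤ _ := hdim
  rw [← Real.exp_log (show (0 : ℝ) < 2 * S.m by linarith), ← Real.exp_add, Real.exp_le_exp]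
  have h3 : s ^ 2 / (2 * (K * (S.n / S.d)))
      = 2 * ((S.d : ℝ) * (S.n : ℝ)⁻¹ / (4 * K / s ^ 2)) := by
    field_simp
    norm_num
  rw [h3]
  linarith

end Setup
end LabelNoise

/-! ### Assembly -/

open LabelNoise in
theorem proposition4p3
    (c₁ c₂ t₁ t₂ κ : ℝ) (p : ℕ)
    (hc : c₁ ≤ c₂) (ht₁ : 0 < t₁) (ht : t₁ ≤ t₂) (ht₂ : t₂ < 1 / 2)
    (hsnr : 2 < c₁ * (1 - 2 * t₂)) (hκ : 1 ≤ κ) :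
    ∃ C C' a b : ℝ, 0 < C ∧ 0 < C' ∧ 0 < a ∧ 0 < b ∧
      ∀ (S : LabelNoise.Setup) (ε δ T : ℝ), S.Basic → 0 < ε → ε < 1 → 0 < δ → δ < 1 →
        S.IsMaxIter κ p ε T → S.MainCondition c₁ c₂ t₁ t₂ C δ T →
        ∃ T₁ : ℕ, a * S.timeScale ≤ T₁ ∧ (T₁ : ℝ) ≤ b * S.timeScale ∧
          S.law {ω : S.Outcome | ¬ (LabelNoise.Setup.IsStageOneEnd a b ω T₁ ∧
            LabelNoise.Setup.testError ω T₁ ≤ Real.exp (-((S.d : ℝ) * (S.n : ℝ)⁻¹ / C')) ∧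
            (∀ i, LabelNoise.Setup.IsClean ω i →
              LabelNoise.Setup.loss ω T₁ i ≤ Real.log 2) ∧
            (∀ i, ¬ LabelNoise.Setup.IsClean ω i →
              Real.log 2 ≤ LabelNoise.Setup.loss ω T₁ i))} ≤ ENNReal.ofReal δ := by
  obtain ⟨c, θ, lam, g, hc₁, hθ₀, hθ₁, hc₀, hc_half, hlam, hlam_le, hg, hg₀, hgap, herr⟩ :=
    Setup.exists_stage_constants hc (ht₁.le.trans ht) hsnr ht₂
  obtain ⟨Y₀, hY₀, hY⟩ := Setup.exists_forall_exp_one_le κ (by linarith) p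
  have hs : 0 < c * g / 8 := by positivity
  have hK : 0 < 3 * (34 + c₂ ^ 2) := by positivity
  generalize hs_def : c * g / 8 = s at hs
  generalize hK_def : 3 * (34 + c₂ ^ 2) = K at hK
  have hA : 0 < c⁻¹ := by positivity
  have hB : 0 < 64 * (1 + c₂ ^ 2) / θ ^ 2 := by positivity
  have hE : 0 < 4 * K / s ^ 2 := by positivity
  -- The summands ensure, in order, `log T ≥ 1`, `cX ≥ 1`, the concentration event, the union over
  -- neurons in the test error, and `m ≥ 2`.
  obtain ⟨C, hC⟩ : ∃ C, C = Y₀ + c⁻¹ + 64 * (1 + c₂ ^ 2) / θ ^ 2 + 4 * K / s ^ 2 + 4 := ⟨_, rfl⟩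
  have hC₀ : 0 < C := by linarith
  refine ⟨C, 4 * K / s ^ 2, c / 8, c₂ + 2, hC₀, hE, by positivity, by linarith, ?_⟩
  intro S ε δ T hS hε hε₁ hδ hδ₁ hT hM
  have hX := hM.timeScale_ge hS hC₀
  have hX₀ := hS.timeScale_pos
  have hlogT : 1 ≤ Real.log T := by
    have h1 : S.timeScale ≤ S.timeScale / ε := le_div_self hX₀.le hε hε₁.le
    have h2 := (hY (S.timeScale / ε) (by linarith)).trans hT.1
    have h3 := Real.log_le_log (Real.exp_pos 1) h2
    rwa [Real.log_exp] at h3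
  have hcX : 1 ≤ c * S.timeScale := by
    have h1 : c⁻¹ ≤ S.timeScale := by linarith
    calc (1 : ℝ) = c * c⁻¹ := (mul_inv_cancel₀ hc₀.ne').symm
      _ ≤ _ := by gcongr
  -- The stopping time is `⌈cX⌉`, which depends on the parameters only; as `cX ≥ 1`, rounding up at
  -- most doubles it.
  have hT₁ : c * S.timeScale ≤ (⌈c * S.timeScale⌉₊ : ℕ) := Nat.le_ceil _
  have hT₁' : ((⌈c * S.timeScale⌉₊ : ℕ) : ℝ) ≤ 2 * c * S.timeScale := by
    have := (Nat.ceil_lt_add_one (show 0 ≤ c * S.timeScale by linarith)).le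
    linarith
  generalize ⌈c * S.timeScale⌉₊ = T₁ at hT₁ hT₁'
  have R : S.Regime c₁ c₂ t₂ c θ lam g T₁ :=
    { basic := hS, two_le := hc₁, c_le := hc, signal_ge := hM.signal_ge hS
      signal_le := hM.signal_le hS, theta_pos := hθ₀, theta_le := hθ₁, c_pos := hc₀
      c_le_half := hc_half, lam_eq := hlam, lam_le := hlam_le, gap_eq := hg, gap_pos := hg₀
      gap_ge := hgap, err_le := herr, time_ge := (le_div_iff₀ hX₀).2 hT₁
      time_le := (div_le_iff₀ hX₀).2 hT₁' }
  refine ⟨T₁, by nlinarith, by nlinarith, ?_⟩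
  have hprob : S.law.real {ω | ¬ Setup.TrainingEvent t₂ θ ω} ≤ δ :=
    hM.law_not_trainingEvent_le hS hδ hδ₁ hlogT ht₁ ht₂ hc₁ hθ₀ (by linarith) (by linarith)
      ((div_le_iff₀ (by positivity)).1 (by linarith))
  have := Setup.isProbabilityMeasure_law (S := S) fun b =>
    ⟨by linarith [(Setup.tau_mem hM b).1], by linarith [(Setup.tau_mem hM b).2]⟩
  -- Monotonicity of the outer measure suffices, so the measurability of the training trajectory
  -- never has to be proved.
  refine le_trans (measure_mono
    (t := {ω : S.Outcome | ¬ Setup.TrainingEvent t₂ θ ω}) fun ω hω hE => hω ?_)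
    ((ENNReal.le_ofReal_iff_toReal_le (measure_ne_top _ _) hδ.le).2 hprob)
  have hσ₀ : S.sigma0 ^ 2 * S.noiseEnergy ≤ S.n / S.d := by
    refine (hM.sigma0_sq_noiseEnergy_le hS hC₀).trans
      (mul_le_of_le_one_left (by positivity) (pow_le_one₀ (by positivity) ?_))
    exact inv_le_one_of_one_le₀ (by linarith)
  refine ⟨R.isStageOneEnd hE, ?_, fun i hi => logisticLoss_le_log_two (R.clean_fit hE hi),
    fun i hi => log_two_le_logisticLoss (R.noisy_unfit hE hi)⟩
  refine (hS.testError_le T₁ hs.le (R.weight_norm_sq_le hE hσ₀) fun b i ζ hζ =>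
    R.test_correct hE b i (by rwa [hs_def])).trans ?_
  rw [hK_def]
  exact hM.two_mul_m_exp_le hS hδ hδ₁ hlogT (by linarith) hs hK (by linarith)
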